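/- Let $K_5-45$ be the complete graph on the vertex set $\{1,2,3,4,5\}$ with the edge $45$ deleted. A (piecewise-linear) map $f:K_5-45\to\mathbb R^2$ consists of a point $f(v)\in\mathbb R^2$ for every vertex $v$ and, for every edge $uv$, a polygonal line $f|_{uv}$ with finitely many segments joining $f(u)$ to $f(v)$ (passed in the reverse order when the edge is directed from $v$ to $u$); self-intersections and intersections are allowed, and $f(uv)$ denotes the union of the segments of $f|_{uv}$. The map $f$ is an almost embedding if the images of any two edges without a common vertex are disjoint, the image of a vertex never lies in the image of an edge not containing that vertex, and distinct vertices have distinct images. For a point $O$ not on a closed polygonal line $A_1\dots A_m$, the winding number of this line around $O$ is $$\frac1{2\pi}\bigl(\angle A_1OA_2+\dots+\angle A_{m-1}OA_m+\angle A_mOA_1\bigr),$$ where $\angle AOB\in(-\pi,\pi]$ is the oriented angle. Let $w_f(123,v)$ denote the winding number around $f(v)$ of the closed polygonal line formed by $f|_{12},f|_{23},f|_{31}$ in this order. Theorem. For any almost embedding $f:K_5-45\to\mathbb R^2$ the points $f(4)$ and $f(5)$ do not lie on $f(12)\cup f(23)\cup f(31)$, the numbers $w_f(123,4)$ and $w_f(123,5)$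 are integers, and (a) $w_f(123,4)-w_f(123,5)\equiv 1\pmod 2$; (b) $w_f(123,4)-w_f(123,5)=1$ or $w_f(123,4)-w_f(123,5)=-1$. -/

import Mathlib

noncomputable section

/-! The plane is `ℂ`. A polygonal line `A₁ … A_m` is the list `[A₁, …, A_m]` of its vertices. -/

/-- The oriented angle `∠AOB ∈ (-π, π]`: the vector `OB` is codirected with `e^{it} • OA`. -/
def orientedAngle (A O B : ℂ) : ℝ := Complex.arg ((B - O) / (A - O))

/-- The union of the segments `A₁A₂, …, A_{m-1}A_m` of the polygonal line `A₁ … A_m`. -/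
def polygonalImage (l : List ℂ) : Set ℂ :=
  {x | ∃ s ∈ l.zip l.tail, x ∈ segment ℝ s.1 s.2}

/-- The winding number around `O` of the closed polygonal line `A₁ … A_m`: the sum of the oriented
angles `∠A₁OA₂, …, ∠A_{m-1}OA_m, ∠A_mOA₁`, divided by `2π`. -/
def polygonalWinding (l : List ℂ) (O : ℂ) : ℝ :=
  (List.zipWith (fun A B => orientedAngle A O B) l (l.rotate 1)).sum / (2 * Real.pi)

/-- A piecewise-linear map of a graph to the plane: a point for every vertex, and for every edge a
polygonal line joining the images of its ends. The line is recorded for both orientations of the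
edge through the list of its intermediate vertices; the two lists are reverse to each other. -/
structure PLMap {V : Type*} (G : SimpleGraph V) where
  pos : V → ℂ
  inner : G.Dart → List ℂ
  inner_symm : ∀ d : G.Dart, inner d.symm = (inner d).reverse

namespace PLMap

variable {V : Type*} {G : SimpleGraph V}

/-- The restriction of the map to an oriented edge, as a polygonal line. -/
def line (f : PLMap G) (d : G.Dart) : List ℂ :=
  f.pos d.fst :: (f.inner d ++ [f.pos d.snd])

/-- The image of an edge. -/
def edgeImage (f : PLMap G) (d : G.Dart) : Set ℂ := polygonalImage (f.line d)

/-- Images of non-adjacent simplices (vertices or edges with no common vertex) are disjoint. -/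
structure IsAlmostEmbedding (f : PLMap G) : Prop where
  edge_edge : ∀ d e : G.Dart, (∀ v, v ∈ d.edge → v ∉ e.edge) →
    Disjoint (f.edgeImage d) (f.edgeImage e)
  vertex_edge : ∀ (v : V) (d : G.Dart), v ∉ d.edge → f.pos v ∉ f.edgeImage d
  vertex_vertex : ∀ u v : V, u ≠ v → f.pos u ≠ f.pos v

/-- The closed polygonal line formed by the polygonal lines of the consecutive edges of a directed
cycle; the last vertex of each line is dropped, being the first vertex of the next one. -/
def closedLine (f : PLMap G) {v : V} (C : G.Walk v v) : List ℂ :=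
  C.darts.flatMap fun d => (f.line d).dropLast

/-- The image of a directed cycle: the union of the images of its edges. -/
def cycleImage (f : PLMap G) {v : V} (C : G.Walk v v) : Set ℂ :=
  {x | ∃ d ∈ C.darts, x ∈ f.edgeImage d}

/-- `w_f(C, u)`, the winding number of `f|_C` around `f(u)`; meaningful if `f(u) ∉ f(C)`. -/
def winding (f : PLMap G) {v : V} (C : G.Walk v v) (u : V) : ℝ :=
  polygonalWinding (f.closedLine C) (f.pos u)

end PLMap

/-- `K₅` without the edge `45`; the vertices `1, 2, 3, 4, 5` are `0, 1, 2, 3, 4 : Fin 5`. -/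
def K5minus45 : SimpleGraph (Fin 5) := (⊤ : SimpleGraph (Fin 5)).deleteEdges {s(3, 4)}

theorem K5minus45_adj_01 : K5minus45.Adj 0 1 := by simp [K5minus45]

theorem K5minus45_adj_12 : K5minus45.Adj 1 2 := by simp [K5minus45]

theorem K5minus45_adj_20 : K5minus45.Adj 2 0 := by simp [K5minus45]

/-- The directed cycle `123`. -/
def cycle123 : K5minus45.Walk 0 0 :=
  .cons K5minus45_adj_01 (.cons K5minus45_adj_12 (.cons K5minus45_adj_20 .nil))

end

/-!
The Möbius transformation `p ↦ (p - f(4)) / (p - f(5))` followed by the logarithm lifts the paths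
`4i5`, `i = 1, 2, 3`, to *strands*: paths in the plane going from far left to far right. The
triangle `123` lifts to a path that ends with a translation by `d · 2πi`, where `d` is the
difference of the two winding numbers; so it must be shown that `d = ±1`.

A strand turns by an odd number of half-turns around a point off it. This number is positive for a
point far above the strand and negative for one far below, so a strand is said to be above another
one if the latter makes a positive number of half-turns around the marked point of the former (the
lift of `f(i)`). For strands that may intersect themselves, and even each other within the first
halves or within the second halves, this is still a strict order, compatible with the translations
by `2πi`. Antisymmetry is a comparison of variations of logarithms over squares. For transitivity,
let `X` be below and `Z` above `Y`, and let `y` be the marked point of `Y`. Off `Y` the logarithm of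
`p - y` has branches that lift `X` and `Z` to paths `ξ` and `ζ` in a half-plane `re ≤ c`; the
orders of the pairs `X, Y` and `Y, Z` say where these start on the line `re = c`. The rotation of
`Z` around the marked point `y + e ^ x` of `X` is the variation of the logarithm of
`e ^ ζ - e ^ x`, which is the product of `e ^ x`, `ζ - x` and `(e ^ (ζ - x) - 1) / (ζ - x)`. The
first half of `ξ`, which is disjoint from `ζ`, determines the contribution of the second factor,
and the second half of `ξ` that of the third one.

A side of the triangle is disjoint from the opposite strand, so the numbers of half-turns of the
latter around both ends of the side are equal. Let `A k` be the number of half-turns of the second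
strand around the marked point of the first one translated by `2πik`. The three sides give
`A (k + d) = -A (-k)`. The sets where `A > 0` and where `A < 0` are closed under addition by
transitivity and contain all large, respectively all very negative, integers; so `A k` has the sign
of `k` for `k ≠ 0`, and hence `d = ±1`.
-/

noncomputable section

open unitInterval
open Complex (exp log slitPlane)
open scoped Real

/-! ### Variation of the logarithm along a path -/

theorem exists_continuous_log_of_exp_eq {g : I → ℂ} (hg : Continuous g) (h0 : ∀ t, g t ≠ 0)
    {w : ℂ} (hw : exp w = g 0) :
    ∃ l : I → ℂ, Continuous l ∧ (∀ t, exp (l t) = g t) ∧ l 0 = w := by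
  obtain ⟨l, hl, hl0⟩ := Complex.isCoveringMap_exp.exists_path_lifts
    ⟨fun t => ⟨g t, h0 t⟩, by fun_prop⟩ w (Subtype.ext hw.symm)
  exact ⟨l, l.continuous, fun t => congrArg Subtype.val (congrFun hl t), hl0⟩

theorem exists_continuous_log {g : I → ℂ} (hg : Continuous g) (h0 : ∀ t, g t ≠ 0) :
    ∃ l : I → ℂ, Continuous l ∧ ∀ t, exp (l t) = g t :=
  let ⟨l, hl, h, _⟩ := exists_continuous_log_of_exp_eq hg h0 (Complex.exp_log (h0 0))
  ⟨l, hl, h⟩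

theorem exists_continuous_log_square {g : I × I → ℂ} (hg : Continuous g) (h0 : ∀ x, g x ≠ 0) :
    ∃ l : I × I → ℂ, Continuous l ∧ ∀ x, exp (l x) = g x := by
  obtain ⟨m, hm, hexp⟩ := exists_continuous_log (g := fun t => g (0, t)) (by fun_prop)
    fun t => h0 _
  let H : C(I × I, {z : ℂ // z ≠ 0}) := ⟨fun x => ⟨g x, h0 x⟩, by fun_prop⟩
  let l := Complex.isCoveringMap_exp.liftHomotopy H ⟨m, hm⟩ fun t => Subtype.ext (hexp t).symm
  have hl := Complex.isCoveringMap_exp.liftHomotopy_lifts H ⟨m, hm⟩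
    fun t => Subtype.ext (hexp t).symm
  exact ⟨l, l.continuous, fun x => congrArg Subtype.val (congrFun hl x)⟩

theorem sub_eq_sub_of_exp_eq {l m : I → ℂ} (hl : Continuous l) (hm : Continuous m)
    (h : ∀ t, exp (l t) = exp (m t)) (s t : I) : l s - m s = l t - m t :=
  Complex.isCoveringMap_exp.const_of_comp (g := fun t => l t - m t) (hl.sub hm)
    (fun s t => Subtype.ext (by simp only [Complex.exp_sub, h, div_self (Complex.exp_ne_zero _)]))
    s t

open Classical in
/-- The variation of the logarithm along a nowhere zero path `g`: the difference of the values at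
the ends of a continuous logarithm of `g`. It is `0` by convention if `g` has none. -/
def logVar (g : I → ℂ) : ℂ :=
  if h : ∃ l : I → ℂ, Continuous l ∧ ∀ t, exp (l t) = g t then h.choose 1 - h.choose 0 else 0

theorem logVar_eq {g l : I → ℂ} (hl : Continuous l) (h : ∀ t, exp (l t) = g t) :
    logVar g = l 1 - l 0 := by
  have hex : ∃ l : I → ℂ, Continuous l ∧ ∀ t, exp (l t) = g t := ⟨l, hl, h⟩
  rw [logVar, dif_pos hex, sub_eq_sub_iff_sub_eq_sub]
  exact sub_eq_sub_of_exp_eq hex.choose_spec.1 hl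
    (fun t => (hex.choose_spec.2 t).trans (h t).symm) 1 0

theorem exp_logVar {g : I → ℂ} (hg : Continuous g) (h0 : ∀ t, g t ≠ 0) :
    exp (logVar g) = g 1 / g 0 := by
  obtain ⟨l, hl, h⟩ := exists_continuous_log hg h0
  rw [logVar_eq hl h, Complex.exp_sub, h, h]

theorem logVar_mul {f g : I → ℂ} (hf : Continuous f) (hf0 : ∀ t, f t ≠ 0)
    (hg : Continuous g) (hg0 : ∀ t, g t ≠ 0) :
    logVar (fun t => f t * g t) = logVar f + logVar g := by
  obtain ⟨l, hl, h⟩ := exists_continuous_log hf hf0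
  obtain ⟨m, hm, h'⟩ := exists_continuous_log hg hg0
  rw [logVar_eq hl h, logVar_eq hm h', logVar_eq (l := fun t => l t + m t) (hl.add hm)
    fun t => by rw [Complex.exp_add, h, h']]
  ring

theorem logVar_div {f g : I → ℂ} (hf : Continuous f) (hf0 : ∀ t, f t ≠ 0)
    (hg : Continuous g) (hg0 : ∀ t, g t ≠ 0) :
    logVar (fun t => f t / g t) = logVar f - logVar g := by
  obtain ⟨l, hl, h⟩ := exists_continuous_log hf hf0
  obtain ⟨m, hm, h'⟩ := exists_continuous_log hg hg0
  rw [logVar_eq hl h, logVar_eq hm h', logVar_eq (l := fun t => l t - m t) (hl.sub hm)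
    fun t => by rw [Complex.exp_sub, h, h']]
  ring

theorem logVar_const_mul {c : ℂ} (hc : c ≠ 0) {g : I → ℂ} (hg : Continuous g)
    (hg0 : ∀ t, g t ≠ 0) : logVar (fun t => c * g t) = logVar g := by
  obtain ⟨l, hl, h⟩ := exists_continuous_log hg hg0
  rw [logVar_eq hl h, logVar_eq (l := fun t => log c + l t) (by fun_prop) fun t => by
    rw [Complex.exp_add, h, Complex.exp_log hc]]
  ring

theorem logVar_neg {g : I → ℂ} (hg : Continuous g) (hg0 : ∀ t, g t ≠ 0) :
    logVar (fun t => -g t) = logVar g := by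
  simpa only [neg_one_mul] using logVar_const_mul (neg_ne_zero.2 one_ne_zero) hg hg0

theorem logVar_sub_comm {f g : I → ℂ} (hf : Continuous f) (hg : Continuous g)
    (h0 : ∀ t, f t ≠ g t) : logVar (fun t => f t - g t) = logVar (fun t => g t - f t) := by
  simpa only [neg_sub] using
    logVar_neg (g := fun t => g t - f t) (hg.sub hf) fun t => sub_ne_zero.2 (h0 t).symm

theorem logVar_of_mem_slitPlane {g : I → ℂ} (hg : Continuous g) (h : ∀ t, g t ∈ slitPlane) :
    logVar g = log (g 1) - log (g 0) :=
  logVar_eq (l := fun t => log (g t)) (hg.clog h)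
    fun t => Complex.exp_log (Complex.slitPlane_ne_zero (h t))

theorem logVar_of_re_pos {g : I → ℂ} (hg : Continuous g) (h : ∀ t, 0 < (g t).re) :
    logVar g = log (g 1) - log (g 0) :=
  logVar_of_mem_slitPlane hg fun t => Or.inl (h t)

theorem logVar_of_re_nonpos {g : I → ℂ} (hg : Continuous g) (h : ∀ t, (g t).re ≤ 0)
    (h0 : ∀ t, g t ≠ 0) : logVar g = log (-g 1) - log (-g 0) := by
  rw [← logVar_neg hg h0]
  refine logVar_of_mem_slitPlane hg.neg fun t => ?_
  have hne : -g t ≠ 0 := neg_ne_zero.2 (h0 t)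
  rcases (h t).lt_or_eq with hre | hre
  · exact Or.inl (by simpa using hre)
  · exact Or.inr fun him => hne (Complex.ext (by simpa using hre) him)

theorem logVar_square {G : I × I → ℂ} (hG : Continuous G) (h0 : ∀ x, G x ≠ 0) :
    logVar (fun t => G (0, t)) + logVar (fun s => G (s, 1)) =
      logVar (fun s => G (s, 0)) + logVar (fun t => G (1, t)) := by
  obtain ⟨l, hl, h⟩ := exists_continuous_log_square hG h0
  rw [logVar_eq (l := fun t => l (0, t)) (by fun_prop) (fun t => h _),
    logVar_eq (l := fun t => l (t, 1)) (by fun_prop) (fun t => h _),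
    logVar_eq (l := fun t => l (t, 0)) (by fun_prop) (fun t => h _),
    logVar_eq (l := fun t => l (1, t)) (by fun_prop) (fun t => h _)]
  ring

theorem continuous_logVar {G : I × I → ℂ} (hG : Continuous G) (h0 : ∀ x, G x ≠ 0) :
    Continuous fun s => logVar fun t => G (s, t) := by
  obtain ⟨l, hl, h⟩ := exists_continuous_log_square hG h0
  have heq : (fun s => logVar fun t => G (s, t)) = fun s => l (s, 1) - l (s, 0) :=
    funext fun s => logVar_eq (l := fun t => l (s, t)) (by fun_prop) fun t => h _
  rw [heq]
  fun_prop

theorem logVar_sub_square {f g : I → ℂ} (hf : Continuous f) (hg : Continuous g)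
    (h : ∀ s t, f s ≠ g t) :
    logVar (fun t => g t - f 0) + logVar (fun s => f s - g 1) =
      logVar (fun s => f s - g 0) + logVar (fun t => g t - f 1) := by
  rw [logVar_sub_comm hf continuous_const (fun s => h s 1),
    logVar_sub_comm hf continuous_const (fun s => h s 0)]
  exact logVar_square (G := fun x => g x.2 - f x.1) (by fun_prop)
    fun x => sub_ne_zero.2 (h x.1 x.2).symm

theorem logVar_path_trans {a b c : ℂ} (γ : Path a b) (δ : Path b c) {p : ℂ}
    (hγ : ∀ t, γ t ≠ p) (hδ : ∀ t, δ t ≠ p) :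
    logVar (fun t => γ.trans δ t - p) =
      logVar (fun t => γ t - p) + logVar (fun t => δ t - p) := by
  obtain ⟨l, hl, hlexp⟩ := exists_continuous_log (g := fun t => γ t - p) (by fun_prop)
    fun t => sub_ne_zero.2 (hγ t)
  obtain ⟨m, hm, hmexp, hm0⟩ := exists_continuous_log_of_exp_eq (g := fun t => δ t - p) (w := l 1)
    (by fun_prop) (fun t => sub_ne_zero.2 (hδ t)) (by rw [hlexp, γ.target, δ.source])
  let lm : Path (l 0) (m 1) := Path.trans ⟨⟨l, hl⟩, rfl, rfl⟩ ⟨⟨m, hm⟩, hm0, rfl⟩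
  have hlm : ∀ t, exp (lm t) = γ.trans δ t - p := fun t => by
    simp only [lm, Path.trans_apply]
    split_ifs
    · exact hlexp _
    · exact hmexp _
  rw [logVar_eq lm.continuous hlm, logVar_eq hl hlexp, logVar_eq hm hmexp, lm.source, lm.target,
    hm0]
  ring

theorem exp_eq_neg_one_iff_exists_odd {z : ℂ} :
    exp z = -1 ↔ ∃ n : ℤ, Odd n ∧ z = n * (π * Complex.I) := by
  constructor
  · rw [← Complex.exp_pi_mul_I, Complex.exp_eq_exp_iff_exists_int]
    rintro ⟨n, rfl⟩
    exact ⟨2 * n + 1, odd_two_mul_add_one n, by push_cast; ring⟩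
  · rintro ⟨n, ⟨k, rfl⟩, rfl⟩
    have hsplit : ((2 * k + 1 : ℤ) : ℂ) * (π * Complex.I) =
        k * (2 * π * Complex.I) + π * Complex.I := by push_cast; ring
    rw [hsplit, Complex.exp_add, Complex.exp_int_mul_two_pi_mul_I, Complex.exp_pi_mul_I, one_mul]

theorem exp_odd_mul_pi_mul_I {n : ℤ} (hn : Odd n) : exp (n * (π * Complex.I)) = -1 :=
  exp_eq_neg_one_iff_exists_odd.2 ⟨n, hn, rfl⟩

theorem log_I_mul_of_re_pos {w : ℂ} (hw : 0 < w.re) :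
    log (Complex.I * w) = log w + π / 2 * Complex.I := by
  have harg := abs_lt.1 (Complex.abs_arg_lt_pi_div_two_iff.2 (Or.inl hw))
  rw [add_comm, ← Complex.log_I,
    Complex.log_mul Complex.I_ne_zero fun h => by simp [h] at hw]
  rw [Complex.arg_I]
  constructor <;> linarith [Real.pi_pos]

theorem log_neg_I_mul_of_re_pos {w : ℂ} (hw : 0 < w.re) :
    log (-Complex.I * w) = log w - π / 2 * Complex.I := by
  have harg := abs_lt.1 (Complex.abs_arg_lt_pi_div_two_iff.2 (Or.inl hw))
  rw [sub_eq_neg_add, ← neg_mul, ← Complex.log_neg_I,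
    Complex.log_mul (neg_ne_zero.2 Complex.I_ne_zero) fun h => by simp [h] at hw]
  rw [Complex.arg_neg_I]
  constructor <;> linarith [Real.pi_pos]

theorem forall_trans_iff {E : Type*} [TopologicalSpace E] {a b c : E} {γ : Path a b}
    {δ : Path b c} {p : E → Prop} :
    (∀ t, p (γ.trans δ t)) ↔ (∀ t, p (γ t)) ∧ ∀ t, p (δ t) := by
  rw [← Set.forall_mem_range (p := p), Path.trans_range]
  simp only [Set.mem_union, or_imp, forall_and, Set.forall_mem_range]

theorem forall_path_segment_of_convex {s : Set ℂ} (hs : Convex ℝ s) {a b : ℂ} (ha : a ∈ s)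
    (hb : b ∈ s) (t : I) : Path.segment a b t ∈ s :=
  hs.segment_subset ha hb (Path.range_segment a b ▸ Set.mem_range_self t)

/-! ### Strands -/

/-- A path from the half-plane `re ≤ -R` to the half-plane `R ≤ re` with a marked point `vert`,
which cuts it into the paths `α` and `β`; the first one stays to the left of the second half-plane,
the second one stays to the right of the first half-plane. -/
structure Strand (R : ℝ) where
  {start vert finish : ℂ}
  α : Path start vert
  β : Path vert finish
  start_re_le : start.re ≤ -R
  le_finish_re : R ≤ finish.re
  re_α_lt : ∀ t, (α t).re < R
  lt_re_β : ∀ t, -R < (β t).re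

namespace Strand

variable {R : ℝ}

theorem vert_re_lt (X : Strand R) : X.vert.re < R := by simpa using X.re_α_lt 1

theorem lt_vert_re (X : Strand R) : -R < X.vert.re := by simpa using X.lt_re_β 0

/-- The whole path of a strand. -/
def path (X : Strand R) : Path X.start X.finish := X.α.trans X.β

/-- The strand does not pass through the point `p`. -/
def Avoids (X : Strand R) (p : ℂ) : Prop := ∀ t, X.path t ≠ p

theorem avoids_iff {X : Strand R} {p : ℂ} :
    X.Avoids p ↔ (∀ t, X.α t ≠ p) ∧ ∀ t, X.β t ≠ p :=
  forall_trans_iff (p := (· ≠ p))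

theorem Avoids.start_ne {X : Strand R} {p : ℂ} (h : X.Avoids p) : X.start ≠ p := by
  simpa using h 0

theorem Avoids.finish_ne {X : Strand R} {p : ℂ} (h : X.Avoids p) : X.finish ≠ p := by
  simpa using h 1

/-- The first part of each of two strands is disjoint from the second part of the other one. -/
def Compat (X Y : Strand R) : Prop := (∀ s t, X.α s ≠ Y.β t) ∧ ∀ s t, Y.α s ≠ X.β t

theorem Compat.symm {X Y : Strand R} (h : X.Compat Y) : Y.Compat X := ⟨h.2, h.1⟩

theorem Compat.avoids {X Y : Strand R} (h : X.Compat Y) : X.Avoids Y.vert :=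
  avoids_iff.2 ⟨fun t => by simpa using h.1 t 0, fun t => by simpa using (h.2 1 t).symm⟩

/-- The variation of the logarithm along a strand seen from a point, corrected by the principal
values at the ends. -/
def turn (X : Strand R) (p : ℂ) : ℂ :=
  logVar (fun t => X.path t - p) - log (X.finish - p) + log (p - X.start)

/-- The rotation of a strand seen from a point, in half-turns; for a point off the strand the
rounded number is itself an odd integer. -/
def halfTurns (X : Strand R) (p : ℂ) : ℤ := round (X.turn p / (π * Complex.I)).re

theorem exp_turn {X : Strand R} {p : ℂ} (h : X.Avoids p) : exp (X.turn p) = -1 := by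
  have hfinish : X.finish - p ≠ 0 := sub_ne_zero.2 h.finish_ne
  have hstart : p - X.start ≠ 0 := sub_ne_zero.2 h.start_ne.symm
  have hstart' : X.start - p ≠ 0 := sub_ne_zero.2 h.start_ne
  rw [turn, Complex.exp_add, Complex.exp_sub, Complex.exp_log hfinish, Complex.exp_log hstart,
    exp_logVar (by fun_prop) fun t => sub_ne_zero.2 (h t), X.path.source, X.path.target]
  field_simp
  ring

theorem halfTurns_of_turn_eq {X : Strand R} {p : ℂ} {n : ℤ}
    (h : X.turn p = n * (π * Complex.I)) : X.halfTurns p = n := by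
  have hpi : (π * Complex.I : ℂ) ≠ 0 := by simp [Real.pi_ne_zero]
  rw [halfTurns, h, mul_div_cancel_right₀ _ hpi, Complex.intCast_re, round_intCast]

theorem turn_eq {X : Strand R} {p : ℂ} (h : X.Avoids p) :
    X.turn p = X.halfTurns p * (π * Complex.I) := by
  obtain ⟨n, -, hn⟩ := exp_eq_neg_one_iff_exists_odd.1 (exp_turn h)
  rw [halfTurns_of_turn_eq hn, hn]

theorem odd_halfTurns {X : Strand R} {p : ℂ} (h : X.Avoids p) : Odd (X.halfTurns p) := by
  obtain ⟨n, hodd, hn⟩ := exp_eq_neg_one_iff_exists_odd.1 (exp_turn h)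
  rwa [halfTurns_of_turn_eq hn]

theorem halfTurns_ne_zero {X : Strand R} {p : ℂ} (h : X.Avoids p) : X.halfTurns p ≠ 0 :=
  fun h0 => by simpa [h0] using odd_halfTurns h

theorem turn_eq_add {X : Strand R} {p : ℂ} (h : X.Avoids p) :
    X.turn p = logVar (fun t => X.α t - p) + logVar (fun t => X.β t - p) -
      log (X.finish - p) + log (p - X.start) := by
  rw [turn, path, logVar_path_trans _ _ (avoids_iff.1 h).1 (avoids_iff.1 h).2]

theorem halfTurns_eq_of_path (X : Strand R) {p q : ℂ} (γ : Path p q)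
    (hl : ∀ t, -R < (γ t).re) (hr : ∀ t, (γ t).re < R) (h : ∀ t, X.Avoids (γ t)) :
    X.halfTurns p = X.halfTurns q := by
  have square := logVar_sub_square γ.continuous X.path.continuous fun s t => (h s t).symm
  have hstart : logVar (fun s => γ s - X.start) = log (q - X.start) - log (p - X.start) := by
    rw [logVar_of_re_pos (by fun_prop) fun t => by
      rw [Complex.sub_re]; linarith [hl t, X.start_re_le], γ.source, γ.target]
  have hfinish : logVar (fun s => γ s - X.finish) =
      log (X.finish - q) - log (X.finish - p) := by
    rw [logVar_sub_comm γ.continuous continuous_const fun t => (h t).finish_ne.symm,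
      logVar_of_re_pos (by fun_prop) fun t => by
        rw [Complex.sub_re]; linarith [hr t, X.le_finish_re], γ.source, γ.target]
  rw [X.path.source, X.path.target, γ.source, γ.target, hstart, hfinish] at square
  rw [halfTurns, halfTurns, turn, turn]
  congr 3
  linear_combination square

theorem logVar_α_add_logVar_β {X Y : Strand R} (h : ∀ s t, X.α s ≠ Y.β t) :
    logVar (fun s => X.α s - Y.vert) + logVar (fun t => Y.β t - X.vert) =
      log (Y.finish - X.vert) - log (Y.vert - X.start) := by
  have square := logVar_sub_square X.α.continuous Y.β.continuous h
  simp only [X.α.source, X.α.target, Y.β.source, Y.β.target] at square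
  have hstart : logVar (fun t => Y.β t - X.start) =
      log (Y.finish - X.start) - log (Y.vert - X.start) := by
    rw [logVar_of_re_pos (by fun_prop) fun t => by
      rw [Complex.sub_re]; linarith [Y.lt_re_β t, X.start_re_le], Y.β.source, Y.β.target]
  have hfinish : logVar (fun s => X.α s - Y.finish) =
      log (Y.finish - X.vert) - log (Y.finish - X.start) := by
    rw [logVar_sub_comm X.α.continuous continuous_const fun t => by simpa using h t 1,
      logVar_of_re_pos (by fun_prop) fun t => by
        rw [Complex.sub_re]; linarith [X.re_α_lt t, Y.le_finish_re], X.α.source, X.α.target]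
  linear_combination hstart + hfinish - square

theorem halfTurns_antisymm {X Y : Strand R} (h : X.Compat Y) :
    X.halfTurns Y.vert = -Y.halfTurns X.vert := by
  apply halfTurns_of_turn_eq
  rw [Int.cast_neg, neg_mul, ← turn_eq h.symm.avoids, turn_eq_add h.avoids,
    turn_eq_add h.symm.avoids]
  linear_combination logVar_α_add_logVar_β h.1 + logVar_α_add_logVar_β h.2

theorem turn_of_forall_re_mul_pos {X : Strand R} {p u : ℂ} (hu : u ≠ 0)
    (h : ∀ t, 0 < (u * (X.path t - p)).re) :
    X.turn p = log (u * (X.finish - p)) - log (u * (X.start - p)) - log (X.finish - p) +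
      log (p - X.start) := by
  rw [turn, ← logVar_const_mul hu (by fun_prop) fun t h0 => by simpa [h0] using h t,
    logVar_of_re_pos (by fun_prop) h, X.path.source, X.path.target]

theorem halfTurns_of_forall_im_lt (X : Strand R) {p : ℂ} (hl : -R < p.re) (hr : p.re < R)
    (h : ∀ t, (X.path t).im < p.im) : X.halfTurns p = 1 := by
  apply halfTurns_of_turn_eq
  have hstart : Complex.I * (X.start - p) = -Complex.I * (p - X.start) := by ring
  rw [turn_of_forall_re_mul_pos Complex.I_ne_zero fun t => by simpa using h t, hstart,
    log_I_mul_of_re_pos (by rw [Complex.sub_re]; linarith [X.le_finish_re]),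
    log_neg_I_mul_of_re_pos (by rw [Complex.sub_re]; linarith [X.start_re_le])]
  push_cast
  ring

theorem halfTurns_of_forall_lt_im (X : Strand R) {p : ℂ} (hl : -R < p.re) (hr : p.re < R)
    (h : ∀ t, p.im < (X.path t).im) : X.halfTurns p = -1 := by
  apply halfTurns_of_turn_eq
  have hstart : -Complex.I * (X.start - p) = Complex.I * (p - X.start) := by ring
  rw [turn_of_forall_re_mul_pos (neg_ne_zero.2 Complex.I_ne_zero) fun t => by simpa using h t,
    hstart, log_neg_I_mul_of_re_pos (by rw [Complex.sub_re]; linarith [X.le_finish_re]),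
    log_I_mul_of_re_pos (by rw [Complex.sub_re]; linarith [X.start_re_le])]
  push_cast
  ring

/-- The strand shifted by `2πik`. -/
def shift (X : Strand R) (k : ℤ) : Strand R where
  α := X.α.map (f := (· + k * (2 * π * Complex.I))) (by fun_prop)
  β := X.β.map (f := (· + k * (2 * π * Complex.I))) (by fun_prop)
  start_re_le := by simpa using X.start_re_le
  le_finish_re := by simpa using X.le_finish_re
  re_α_lt t := by simpa using X.re_α_lt t
  lt_re_β t := by simpa using X.lt_re_β t

theorem shift_vert (X : Strand R) (k : ℤ) :
    (X.shift k).vert = X.vert + k * (2 * π * Complex.I) := rfl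

theorem shift_path_apply (X : Strand R) (k : ℤ) (t : I) :
    (X.shift k).path t = X.path t + k * (2 * π * Complex.I) :=
  (DFunLike.congr_fun (Path.map_trans X.α X.β (f := (· + k * (2 * π * Complex.I)))
    (by fun_prop)) t).symm

theorem halfTurns_shift (X : Strand R) (k : ℤ) (p : ℂ) :
    (X.shift k).halfTurns p = X.halfTurns (p - k * (2 * π * Complex.I)) := by
  have hstart : (X.shift k).start = X.start + k * (2 * π * Complex.I) := rfl
  have hfinish : (X.shift k).finish = X.finish + k * (2 * π * Complex.I) := rfl
  simp only [halfTurns, turn, shift_path_apply, hstart, hfinish, sub_sub_eq_add_sub, sub_right_comm,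
    sub_sub, add_comm]

/-- The strand with its ends joined by segments to new ends. -/
def extend (X : Strand R) (a b : ℂ) (ha : a.re ≤ -R) (hb : R ≤ b.re) : Strand R where
  α := (Path.segment a X.start).trans X.α
  β := X.β.trans (Path.segment X.finish b)
  start_re_le := ha
  le_finish_re := hb
  re_α_lt := (forall_trans_iff (p := fun z : ℂ => z.re < R)).2 ⟨fun t =>
    have hle : (Path.segment a X.start t).re ≤ -R :=
      forall_path_segment_of_convex (convex_halfSpace_re_le (-R)) ha X.start_re_le t
    hle.trans_lt (X.lt_vert_re.trans X.vert_re_lt), X.re_α_lt⟩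
  lt_re_β := (forall_trans_iff (p := fun z : ℂ => -R < z.re)).2 ⟨X.lt_re_β, fun t =>
    have hle : R ≤ (Path.segment X.finish b t).re :=
      forall_path_segment_of_convex (convex_halfSpace_re_ge R) X.le_finish_re hb t
    (X.lt_vert_re.trans X.vert_re_lt).trans_le hle⟩

theorem logVar_segment_sub_of_re_le {a b p : ℂ} (ha : a.re ≤ -R) (hb : b.re ≤ -R)
    (hp : -R < p.re) :
    logVar (fun t => Path.segment a b t - p) = log (p - b) - log (p - a) := by
  have hle : ∀ t, (Path.segment a b t).re ≤ -R :=
    forall_path_segment_of_convex (convex_halfSpace_re_le (-R)) ha hb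
  have hne : ∀ t, Path.segment a b t ≠ p := fun t h => by linarith [h ▸ hle t]
  rw [logVar_sub_comm (by fun_prop) continuous_const hne,
    logVar_of_re_pos (by fun_prop) fun t => by rw [Complex.sub_re]; linarith [hle t],
    Path.source, Path.target]

theorem logVar_segment_sub_of_le_re {a b p : ℂ} (ha : R ≤ a.re) (hb : R ≤ b.re)
    (hp : p.re < R) :
    logVar (fun t => Path.segment a b t - p) = log (b - p) - log (a - p) := by
  have hle : ∀ t, R ≤ (Path.segment a b t).re :=
    forall_path_segment_of_convex (convex_halfSpace_re_ge R) ha hb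
  rw [logVar_of_re_pos (by fun_prop) fun t => by rw [Complex.sub_re]; linarith [hle t],
    Path.source, Path.target]

theorem avoids_extend {X : Strand R} {a b : ℂ} {ha : a.re ≤ -R} {hb : R ≤ b.re} {p : ℂ}
    (h : X.Avoids p) (hl : -R < p.re) (hr : p.re < R) : (X.extend a b ha hb).Avoids p :=
  avoids_iff.2 ⟨(forall_trans_iff (p := (· ≠ p))).2 ⟨fun t h' => hl.not_ge <| h' ▸
      forall_path_segment_of_convex (convex_halfSpace_re_le (-R)) ha X.start_re_le t,
        (avoids_iff.1 h).1⟩,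
    (forall_trans_iff (p := (· ≠ p))).2 ⟨(avoids_iff.1 h).2, fun t h' => hr.not_ge <| h' ▸
      forall_path_segment_of_convex (convex_halfSpace_re_ge R) X.le_finish_re hb t⟩⟩

theorem halfTurns_extend {X : Strand R} {a b : ℂ} {ha : a.re ≤ -R} {hb : R ≤ b.re} {p : ℂ}
    (h : X.Avoids p) (hl : -R < p.re) (hr : p.re < R) :
    (X.extend a b ha hb).halfTurns p = X.halfTurns p := by
  have hext := avoids_iff.1 (avoids_extend (ha := ha) (hb := hb) h hl hr)
  have hα := logVar_path_trans _ _ ((forall_trans_iff (p := (· ≠ p))).1 hext.1).1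
    (avoids_iff.1 h).1
  have hβ := logVar_path_trans _ _ (avoids_iff.1 h).2
    ((forall_trans_iff (p := (· ≠ p))).1 hext.2).2
  rw [logVar_segment_sub_of_re_le ha X.start_re_le hl] at hα
  rw [logVar_segment_sub_of_le_re X.le_finish_re hb hr] at hβ
  apply halfTurns_of_turn_eq
  rw [← turn_eq h, turn_eq_add h, turn_eq_add (avoids_iff.2 hext)]
  change logVar (fun t => (Path.trans _ X.α) t - p) + logVar (fun t => (X.β.trans _) t - p) -
    log (b - p) + log (p - a) = _
  linear_combination hα + hβ

theorem Compat.extend {X Y : Strand R} (h : X.Compat Y) {a b : ℂ} (ha : a.re ≤ -R)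
    (hb : R ≤ b.re) : (X.extend a b ha hb).Compat Y := by
  constructor
  · intro s t
    revert s
    refine (forall_trans_iff (p := (· ≠ Y.β t))).2 ⟨fun s h' => (Y.lt_re_β t).not_ge <| h' ▸
      forall_path_segment_of_convex (convex_halfSpace_re_le (-R)) ha X.start_re_le s,
        fun s => h.1 s t⟩
  · intro s
    refine (forall_trans_iff (p := (Y.α s ≠ ·))).2 ⟨h.2 s, fun t h' => (Y.re_α_lt s).not_ge <|
      h' ▸ forall_path_segment_of_convex (convex_halfSpace_re_ge R) X.le_finish_re hb t⟩

theorem exists_abs_im_path_le (X : Strand R) : ∃ C, ∀ t, |(X.path t).im| ≤ C := by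
  have hcompact : IsCompact (Set.range fun t => (X.path t).im) := isCompact_range (by fun_prop)
  obtain ⟨C, hC⟩ := hcompact.isBounded.exists_norm_le
  exact ⟨C, fun t => hC _ ⟨t, rfl⟩⟩

theorem eventually_halfTurns_eq_one (X : Strand R) {p : ℂ} (hl : -R < p.re) (hr : p.re < R) :
    ∀ᶠ k : ℤ in .atTop, X.halfTurns (p + k * (2 * π * Complex.I)) = 1 := by
  obtain ⟨C, hC⟩ := X.exists_abs_im_path_le
  have htop : Filter.Tendsto (fun k : ℤ => p.im + k * (2 * π)) .atTop .atTop :=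
    Filter.tendsto_atTop_add_const_left _ _
      (tendsto_intCast_atTop_atTop.atTop_mul_const (by positivity))
  filter_upwards [htop.eventually_gt_atTop C] with k hk
  refine X.halfTurns_of_forall_im_lt (by simpa) (by simpa) fun t => ?_
  simpa using (le_of_abs_le (hC t)).trans_lt hk

theorem eventually_halfTurns_eq_neg_one (X : Strand R) {p : ℂ} (hl : -R < p.re)
    (hr : p.re < R) :
    ∀ᶠ k : ℤ in .atBot, X.halfTurns (p + k * (2 * π * Complex.I)) = -1 := by
  obtain ⟨C, hC⟩ := X.exists_abs_im_path_le
  have hbot : Filter.Tendsto (fun k : ℤ => p.im + k * (2 * π)) .atBot .atBot :=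
    Filter.tendsto_atBot_add_const_left _ _
      ((tendsto_intCast_atBot_iff.2 Filter.tendsto_id).atBot_mul_const (by positivity))
  filter_upwards [hbot.eventually_lt_atBot (-C)] with k hk
  refine X.halfTurns_of_forall_lt_im (by simpa) (by simpa) fun t => ?_
  simpa using hk.trans_le (neg_le_of_abs_le (hC t))

end Strand

/-! ### Variation of the logarithm under the exponential -/

/-- The entire function `(e ^ w - 1) / w`. -/
def expQuot (w : ℂ) : ℂ := dslope exp 0 w

theorem continuous_expQuot : Continuous expQuot := by
  rw [continuous_iff_continuousAt]
  intro w
  rcases eq_or_ne w 0 with rfl | hw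
  · exact continuousAt_dslope_same.2 Complex.differentiableAt_exp
  · exact (continuousAt_dslope_of_ne hw).2 Complex.continuous_exp.continuousAt

theorem mul_expQuot (w : ℂ) : w * expQuot w = exp w - 1 := by
  simpa [expQuot] using sub_smul_dslope exp 0 w

theorem expQuot_zero : expQuot 0 = 1 := by simp [expQuot]

theorem expQuot_ne_zero {w : ℂ} (h : exp w = 1 → w = 0) : expQuot w ≠ 0 := by
  intro h0
  have hexp : exp w = 1 := by rw [← sub_eq_zero, ← mul_expQuot, h0, mul_zero]
  rw [h hexp, expQuot_zero] at h0
  exact one_ne_zero h0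

theorem expQuot_eq_exp_mul (w : ℂ) : expQuot w = exp w * expQuot (-w) := by
  rcases eq_or_ne w 0 with rfl | hw
  · simp
  · have hinv : exp w * exp (-w) = 1 := by rw [← Complex.exp_add]; simp
    apply mul_left_cancel₀ hw
    linear_combination mul_expQuot w + exp w * mul_expQuot (-w) + hinv

theorem re_one_sub_exp_pos {w : ℂ} (hw : w.re ≤ 0) (h : exp w ≠ 1) : 0 < (1 - exp w).re := by
  have hnorm : ‖exp w‖ ≤ 1 := by rw [Complex.norm_exp]; exact Real.exp_le_one_iff.2 hw
  have hre : (exp w).re ≤ 1 := (Complex.re_le_norm _).trans hnorm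
  rw [Complex.sub_re, Complex.one_re, sub_pos]
  refine hre.lt_of_ne fun hre1 => h (Complex.ext hre1 ?_)
  have hsq := Complex.normSq_eq_norm_sq (exp w)
  rw [Complex.normSq_apply, hre1] at hsq
  rw [Complex.one_im]
  nlinarith [norm_nonneg (exp w)]

/-- On the left half-plane the quotient of `1 - e ^ w` and `-w`, both of which lie in the right
half-plane, takes values in the slit plane. -/
theorem expQuot_mem_slitPlane_and_log {w : ℂ} (hw : w.re ≤ 0) (h : exp w ≠ 1) :
    expQuot w ∈ slitPlane ∧ log (expQuot w) = log (1 - exp w) - log (-w) := by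
  have hw0 : -w ≠ 0 := neg_ne_zero.2 fun h' => h (by simp [h'])
  have hnum := abs_lt.1 (Complex.abs_arg_lt_pi_div_two_iff.2 (Or.inl (re_one_sub_exp_pos hw h)))
  have hden := abs_le.1
    (Complex.abs_arg_le_pi_div_two_iff.2 (Complex.neg_re w ▸ neg_nonneg.2 hw : 0 ≤ (-w).re))
  have hexp : exp (log (1 - exp w) - log (-w)) = expQuot w := by
    rw [Complex.exp_sub, Complex.exp_log (sub_ne_zero.2 h.symm), Complex.exp_log hw0,
      div_eq_iff hw0]
    linear_combination mul_expQuot w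
  have him : (log (1 - exp w) - log (-w)).im = (1 - exp w).arg - (-w).arg := by
    simp [Complex.log_im]
  have hlog : log (expQuot w) = log (1 - exp w) - log (-w) := by
    rw [← hexp, Complex.log_exp] <;> rw [him] <;> linarith
  refine ⟨Complex.mem_slitPlane_iff_arg.2 ⟨?_, hexp ▸ Complex.exp_ne_zero _⟩, hlog⟩
  rw [← Complex.log_im, hlog, him]
  exact ne_of_lt (by linarith)

theorem log_expQuot {w : ℂ} (hw : w.re ≤ 0) (h : exp w ≠ 1) :
    log (expQuot w) = log (1 - exp w) - log (-w) :=
  (expQuot_mem_slitPlane_and_log hw h).2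

theorem expQuot_mem_slitPlane {w : ℂ} (hw : w.re ≤ 0) (h : exp w = 1 → w = 0) :
    expQuot w ∈ slitPlane := by
  rcases eq_or_ne w 0 with rfl | h0
  · rw [expQuot_zero]; exact Complex.one_mem_slitPlane
  · exact (expQuot_mem_slitPlane_and_log hw (mt h h0)).1

theorem logVar_expQuot_of_re_nonpos {w : I → ℂ} (hw : Continuous w) (h : ∀ t, (w t).re ≤ 0)
    (h0 : ∀ t, exp (w t) = 1 → w t = 0) :
    logVar (fun t => expQuot (w t)) = log (expQuot (w 1)) - log (expQuot (w 0)) :=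
  logVar_of_mem_slitPlane (continuous_expQuot.comp hw) fun t => expQuot_mem_slitPlane (h t) (h0 t)

theorem logVar_expQuot_of_re_nonneg {w : I → ℂ} (hw : Continuous w) (h : ∀ t, 0 ≤ (w t).re)
    (h0 : ∀ t, exp (w t) = 1 → w t = 0) :
    logVar (fun t => expQuot (w t)) =
      w 1 - w 0 + (log (expQuot (-w 1)) - log (expQuot (-w 0))) := by
  have hneg : ∀ t, exp (-w t) = 1 → -w t = 0 := fun t ht => by
    rw [Complex.exp_neg, inv_eq_one] at ht
    rw [h0 t ht, neg_zero]
  simp only [expQuot_eq_exp_mul (w _)]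
  rw [logVar_mul (g := fun t => expQuot (-w t)) hw.cexp (fun t => Complex.exp_ne_zero _)
      (continuous_expQuot.comp hw.neg) (fun t => expQuot_ne_zero (hneg t)),
    logVar_eq hw fun t => rfl,
    logVar_expQuot_of_re_nonpos (w := fun t => -w t) hw.neg (fun t => by simpa using h t) hneg]

theorem exp_sub_eq_one_iff {z w : ℂ} : exp (z - w) = 1 ↔ exp z = exp w := by
  rw [Complex.exp_sub, div_eq_one_iff_eq (Complex.exp_ne_zero _)]

theorem logVar_exp_sub_exp {ζ : I → ℂ} (hζ : Continuous ζ) {x : ℂ}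
    (h : ∀ t, exp (ζ t) ≠ exp x) :
    logVar (fun t => exp (ζ t) - exp x) =
      logVar (fun t => ζ t - x) + logVar (fun t => expQuot (ζ t - x)) := by
  have hlin : ∀ t, ζ t - x ≠ 0 := fun t h' => h t (by rw [sub_eq_zero.1 h'])
  have hquot : ∀ t, expQuot (ζ t - x) ≠ 0 := fun t => expQuot_ne_zero fun h' =>
    absurd (exp_sub_eq_one_iff.1 h') (h t)
  have hcont : Continuous fun t => expQuot (ζ t - x) := continuous_expQuot.comp (by fun_prop)
  have hfactor : ∀ t, exp (ζ t) - exp x = exp x * ((ζ t - x) * expQuot (ζ t - x)) := fun t => by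
    rw [mul_expQuot, mul_sub, ← Complex.exp_add, add_sub_cancel, mul_one]
  simp only [hfactor]
  rw [logVar_const_mul (Complex.exp_ne_zero x) (by fun_prop) fun t =>
      mul_ne_zero (hlin t) (hquot t),
    logVar_mul (by fun_prop) hlin hcont hquot]

theorem log_neg_of_im_pos {z : ℂ} (hz : 0 < z.im) : log (-z) = log z - π * Complex.I := by
  rw [Complex.log, Complex.log, norm_neg, Complex.arg_neg_eq_arg_sub_pi_of_im_pos hz]
  push_cast
  ring

theorem logVar_path_sub_of_re_le {c : ℝ} {a b a' x : ℂ} (ζ : Path a b) (ξ : Path a' x)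
    (hζ : ∀ t, (ζ t).re ≤ c) (hξ : ∀ s, (ξ s).re ≤ c) (ha : a.re = c) (hb : b.re = c)
    (ha' : a'.re = c) (haa' : a'.im < a.im) (hba' : a'.im < b.im) (h : ∀ s t, ξ s ≠ ζ t) :
    logVar (fun t => ζ t - x) = log (b - x) - log (a - x) := by
  have square := logVar_sub_square ξ.continuous ζ.continuous h
  have hζa' := logVar_of_re_nonpos (g := fun t => ζ t - a') (by fun_prop)
    (fun t => by rw [Complex.sub_re]; linarith [hζ t])
    fun t => sub_ne_zero.2 (by simpa using (h 0 t).symm)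
  have hξb := logVar_of_re_nonpos (g := fun s => ξ s - b) (by fun_prop)
    (fun s => by rw [Complex.sub_re]; linarith [hξ s])
    fun s => sub_ne_zero.2 (by simpa using h s 1)
  have hξa := logVar_of_re_nonpos (g := fun s => ξ s - a) (by fun_prop)
    (fun s => by rw [Complex.sub_re]; linarith [hξ s])
    fun s => sub_ne_zero.2 (by simpa using h s 0)
  have hloga := log_neg_of_im_pos (z := a - a') (by simpa using haa')
  have hlogb := log_neg_of_im_pos (z := b - a') (by simpa using hba')
  simp only [Path.source, Path.target, neg_sub] at square hζa' hξb hξa hloga hlogb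
  linear_combination -square + hζa' + hξb - hξa - hloga + hlogb

theorem logVar_expQuot_path_sub_of_re_le {c : ℝ} {a b x : ℂ} (ζ : Path a b) (ξ : Path x b)
    (hζ : ∀ t, (ζ t).re ≤ c) (hξ : ∀ s, (ξ s).re ≤ c) (ha : a.re = c) (hb : b.re = c)
    (hab : b.im < a.im) (hexp : exp a = -exp b)
    (h : ∀ s t, exp (ξ s) = exp (ζ t) → ξ s = ζ t) :
    logVar (fun t => expQuot (ζ t - x)) =
      log (expQuot (x - b)) - log (expQuot (x - a)) - π * Complex.I := by
  have h' : ∀ s t, exp (ζ t - ξ s) = 1 → ζ t - ξ s = 0 := fun s t hst =>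
    sub_eq_zero.2 (h s t (exp_sub_eq_one_iff.1 hst).symm).symm
  have square := logVar_square (G := fun z => expQuot (ζ z.2 - ξ z.1))
    (continuous_expQuot.comp (by fun_prop)) fun z => expQuot_ne_zero (h' z.1 z.2)
  have hζb := logVar_expQuot_of_re_nonpos (w := fun t => ζ t - b) (by fun_prop)
    (fun t => by rw [Complex.sub_re]; linarith [hζ t]) fun t => by simpa using h' 1 t
  have hξb := logVar_expQuot_of_re_nonneg (w := fun s => b - ξ s) (by fun_prop)
    (fun s => by rw [Complex.sub_re]; linarith [hξ s]) fun s => by simpa using h' s 1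
  have hξa := logVar_expQuot_of_re_nonneg (w := fun s => a - ξ s) (by fun_prop)
    (fun s => by rw [Complex.sub_re]; linarith [hξ s]) fun s => by simpa using h' s 0
  have hab' : exp (a - b) = -1 := by
    rw [Complex.exp_sub, hexp, neg_div, div_self (Complex.exp_ne_zero _)]
  have hba' : exp (b - a) = -1 := by
    rw [Complex.exp_sub, hexp, div_neg, div_self (Complex.exp_ne_zero _)]
  have hloga := log_expQuot (w := a - b) (by simp [ha, hb]) (by rw [hab']; norm_num)
  have hlogb := log_expQuot (w := b - a) (by simp [ha, hb]) (by rw [hba']; norm_num)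
  have hlog := log_neg_of_im_pos (z := a - b) (by simpa using hab)
  simp only [hab', hba', Path.source, Path.target, neg_sub, sub_self, neg_zero, expQuot_zero,
    Complex.log_one] at square hζb hξb hξa hloga hlogb hlog
  linear_combination square + hζb - hξb + hξa - hloga + hlogb + hlog

/-- The path `ξα`, which is disjoint from `ζ`, controls the factor `ζ t - x` of
`exp (ζ t) - exp x`; the path `ξβ`, which may meet `ζ` but not its nontrivial translates by
multiples of `2πi`, controls the factor `expQuot (ζ t - x)`. -/
theorem logVar_exp_path_sub_exp {c : ℝ} {a a' b b' x : ℂ} (ζ : Path a b) (ξα : Path a' x)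
    (ξβ : Path x b') (hζ : ∀ t, (ζ t).re ≤ c) (hξα : ∀ s, (ξα s).re ≤ c)
    (hξβ : ∀ s, (ξβ s).re ≤ c) (ha : a.re = c) (ha' : a'.re = c) (hb : b = c)
    (hb' : b' = c) (ha_im : 0 < a.im) (ha_im' : a'.im < 0) (hexp : exp a = -exp c)
    (hne : ∀ t, exp (ζ t) ≠ exp x) (hα : ∀ s t, ξα s ≠ ζ t)
    (hβ : ∀ s t, exp (ξβ s) = exp (ζ t) → ξβ s = ζ t) :
    logVar (fun t => exp (ζ t) - exp x) =
      log (exp c - exp x) - log (exp c + exp x) - π * Complex.I := by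
  subst hb hb'
  have hx : x.re ≤ c := by simpa using hξβ 0
  have hxc : exp (x - c) ≠ 1 := mt exp_sub_eq_one_iff.1 (by simpa using (hne 1).symm)
  have hxa : exp (x - a) ≠ 1 := mt exp_sub_eq_one_iff.1 (by simpa using (hne 0).symm)
  have hsubc : exp c - exp x = Real.exp c * (1 - exp (x - c)) := by
    rw [Complex.ofReal_exp, mul_sub, mul_one, ← Complex.exp_add, add_sub_cancel]
  have hsuba : exp c + exp x = Real.exp c * (1 - exp (x - a)) := by
    rw [Complex.ofReal_exp, Complex.exp_sub, hexp]
    field_simp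
    ring
  rw [logVar_exp_sub_exp ζ.continuous hne,
    logVar_path_sub_of_re_le ζ ξα hζ hξα ha (Complex.ofReal_re c) ha' (ha_im'.trans ha_im)
      (by simpa using ha_im') hα,
    logVar_expQuot_path_sub_of_re_le ζ ξβ hζ hξβ ha (Complex.ofReal_re c) (by simpa using ha_im)
      hexp hβ,
    log_expQuot (by simpa using hx) hxc, log_expQuot (by simpa [ha] using hx) hxa, hsubc, hsuba,
    Complex.log_ofReal_mul (Real.exp_pos c) (sub_ne_zero.2 hxc.symm),
    Complex.log_ofReal_mul (Real.exp_pos c) (sub_ne_zero.2 hxa.symm), neg_sub, neg_sub]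
  ring

/-! ### Transitivity -/

theorem log_exp_ofReal (c : ℝ) : log (exp c) = c := by
  rw [← Complex.ofReal_exp, ← Complex.ofReal_log (Real.exp_pos c).le, Real.log_exp]

theorem eventually_forall_norm_lt_exp {g : I → ℂ} (hg : Continuous g) :
    ∀ᶠ R in Filter.atTop, ∀ t, ‖g t‖ < Real.exp R := by
  obtain ⟨C, hC⟩ := (isCompact_range hg).isBounded.exists_norm_le
  filter_upwards [Real.tendsto_exp_atTop.eventually_gt_atTop C] with R hR t
  exact (hC _ ⟨t, rfl⟩).trans_lt hR

namespace Strand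

variable {R : ℝ}

/-- The branch of `log (Y.vert - p)` off the second part of the strand `Y`, to the left of the
half-plane where it ends. -/
def logLeft (Y : Strand R) (p : ℂ) : ℂ := log (Y.finish - p) - logVar (fun t => Y.β t - p)

/-- The branch of `log (p - Y.vert)` off the first part of the strand `Y`, to the right of the
half-plane where it starts. -/
def logRight (Y : Strand R) (p : ℂ) : ℂ := log (p - Y.start) + logVar (fun t => Y.α t - p)

theorem logRight_eq_logLeft_add {Y : Strand R} {p : ℂ} (h : Y.Avoids p) :
    Y.logRight p = Y.logLeft p + Y.halfTurns p * (π * Complex.I) := by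
  rw [logLeft, logRight, ← turn_eq h, turn_eq_add h]
  ring

theorem exp_logLeft {Y : Strand R} {p : ℂ} (h : ∀ t, Y.β t ≠ p) :
    exp (Y.logLeft p) = Y.vert - p := by
  have hfinish : Y.finish - p ≠ 0 := sub_ne_zero.2 (by simpa using h 1)
  have hvert : Y.vert - p ≠ 0 := sub_ne_zero.2 (by simpa using h 0)
  rw [logLeft, Complex.exp_sub, Complex.exp_log hfinish,
    exp_logVar (by fun_prop) fun t => sub_ne_zero.2 (h t), Y.β.source, Y.β.target]
  field_simp

theorem exp_logRight {Y : Strand R} {p : ℂ} (h : ∀ t, Y.α t ≠ p) :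
    exp (Y.logRight p) = p - Y.vert := by
  have hstart : p - Y.start ≠ 0 := sub_ne_zero.2 (by simpa using (h 0).symm)
  have hstart' : Y.start - p ≠ 0 := sub_ne_zero.2 (by simpa using h 0)
  rw [logRight, Complex.exp_add, Complex.exp_log hstart,
    exp_logVar (by fun_prop) fun t => sub_ne_zero.2 (h t), Y.α.source, Y.α.target]
  field_simp
  ring

theorem continuous_logLeft {Y : Strand R} {g : I → ℂ} (hg : Continuous g)
    (hr : ∀ t, (g t).re < R) (h : ∀ s t, g s ≠ Y.β t) : Continuous fun s => Y.logLeft (g s) := by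
  refine Continuous.sub (Continuous.clog (by fun_prop) fun t => Or.inl ?_) ?_
  · rw [Complex.sub_re]
    linarith [hr t, Y.le_finish_re]
  · exact continuous_logVar (G := fun x => Y.β x.2 - g x.1) (by fun_prop)
      fun x => sub_ne_zero.2 (h _ _).symm

theorem continuous_logRight {Y : Strand R} {g : I → ℂ} (hg : Continuous g)
    (hl : ∀ t, -R < (g t).re) (h : ∀ s t, Y.α s ≠ g t) :
    Continuous fun s => Y.logRight (g s) := by
  refine Continuous.add (Continuous.clog (by fun_prop) fun t => Or.inl ?_) ?_
  · rw [Complex.sub_re]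
    linarith [hl t, Y.start_re_le]
  · exact continuous_logVar (G := fun x => Y.α x.2 - g x.1) (by fun_prop)
      fun x => sub_ne_zero.2 (h _ _)

theorem logLeft_of_re_le (Y : Strand R) {p : ℂ} (hp : p.re ≤ -R) :
    Y.logLeft p = log (Y.vert - p) := by
  rw [logLeft, logVar_of_re_pos (by fun_prop) fun t => by
    rw [Complex.sub_re]; linarith [Y.lt_re_β t], Y.β.source, Y.β.target]
  ring

theorem logRight_of_le_re (Y : Strand R) {p : ℂ} (hp : R ≤ p.re) :
    Y.logRight p = log (p - Y.vert) := by
  have hre : ∀ t, 0 < (p - Y.α t).re := fun t => by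
    rw [Complex.sub_re]; linarith [Y.re_α_lt t]
  rw [logRight, logVar_sub_comm (by fun_prop) continuous_const
      fun t h => by simpa [h] using hre t,
    logVar_of_re_pos (by fun_prop) hre, Y.α.source, Y.α.target]
  ring

theorem logLeft_vert_sub_exp {Y : Strand R} {c : ℝ} (h : (Y.vert - exp c).re ≤ -R) :
    Y.logLeft (Y.vert - exp c) = c := by
  rw [logLeft_of_re_le Y h, sub_sub_cancel, log_exp_ofReal]

theorem logRight_vert_add_exp {Y : Strand R} {c : ℝ} (h : R ≤ (Y.vert + exp c).re) :
    Y.logRight (Y.vert + exp c) = c := by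
  rw [logRight_of_le_re Y h, add_sub_cancel_left, log_exp_ofReal]

/-- The lift of the first part of the strand `X` under `p ↦ Y.vert + exp p` that continues
`liftβ` backwards. -/
def liftα {X Y : Strand R} (h : X.Compat Y) :
    Path (Y.logLeft X.start + Y.halfTurns X.vert * (π * Complex.I)) (Y.logRight X.vert) where
  toFun t := Y.logLeft (X.α t) + Y.halfTurns X.vert * (π * Complex.I)
  continuous_toFun := (continuous_logLeft X.α.continuous X.re_α_lt h.1).add continuous_const
  source' := by rw [X.α.source]
  target' := by rw [X.α.target, logRight_eq_logLeft_add h.symm.avoids]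

/-- The lift of the second part of the strand `X` under `p ↦ Y.vert + exp p`. -/
def liftβ {X Y : Strand R} (h : X.Compat Y) :
    Path (Y.logRight X.vert) (Y.logRight X.finish) where
  toFun t := Y.logRight (X.β t)
  continuous_toFun := continuous_logRight X.β.continuous X.lt_re_β h.2
  source' := by rw [X.β.source]
  target' := by rw [X.β.target]

theorem exp_liftα {X Y : Strand R} (h : X.Compat Y) (t : I) :
    exp (liftα h t) = X.α t - Y.vert := by
  change exp (_ + _) = _
  rw [Complex.exp_add, exp_odd_mul_pi_mul_I (odd_halfTurns h.symm.avoids),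
    exp_logLeft fun s => (h.1 t s).symm]
  ring

theorem exp_liftβ {X Y : Strand R} (h : X.Compat Y) (t : I) :
    exp (liftβ h t) = X.β t - Y.vert :=
  exp_logRight fun s => h.2 s t

theorem exp_lift {X Y : Strand R} (h : X.Compat Y) (t : I) :
    exp ((liftα h).trans (liftβ h) t) = X.path t - Y.vert := by
  simp only [path, Path.trans_apply]
  split_ifs
  · exact exp_liftα h _
  · exact exp_liftβ h _

theorem liftα_ne_lift {X Y Z : Strand R} (hXY : X.Compat Y) (hZY : Z.Compat Y)
    (hXZ : X.Compat Z) (h : Y.halfTurns X.vert ≠ Y.halfTurns Z.vert) (s t : I) :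
    liftα hXY s ≠ (liftα hZY).trans (liftβ hZY) t := by
  revert t
  refine (forall_trans_iff (p := (liftα hXY s ≠ ·))).2 ⟨fun t heq => h ?_, fun t heq => ?_⟩
  · have hpi : (π * Complex.I : ℂ) ≠ 0 := by simp [Real.pi_ne_zero]
    have hpoint : X.α s = Z.α t :=
      sub_left_inj.1 (by rw [← exp_liftα hXY, ← exp_liftα hZY, heq])
    change Y.logLeft (X.α s) + _ = Y.logLeft (Z.α t) + _ at heq
    rw [hpoint, add_right_inj] at heq
    exact Int.cast_injective (mul_right_cancel₀ hpi heq)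
  · exact hXZ.1 s t (sub_left_inj.1 (by rw [← exp_liftα hXY, ← exp_liftβ hZY, heq]))

theorem liftβ_eq_lift_of_exp_eq {X Y Z : Strand R} (hXY : X.Compat Y) (hZY : Z.Compat Y)
    (hXZ : X.Compat Z) (s t : I)
    (h : exp (liftβ hXY s) = exp ((liftα hZY).trans (liftβ hZY) t)) :
    liftβ hXY s = (liftα hZY).trans (liftβ hZY) t := by
  revert t
  refine (forall_trans_iff
    (p := fun z => exp (liftβ hXY s) = exp z → liftβ hXY s = z)).2
      ⟨fun t heq => ?_, fun t heq => ?_⟩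
  · rw [exp_liftβ, exp_liftα] at heq
    exact absurd (sub_left_inj.1 heq) (hXZ.2 t s).symm
  · rw [exp_liftβ, exp_liftβ] at heq
    exact congrArg Y.logRight (sub_left_inj.1 heq)

theorem halfTurns_trans_of_ends {X Y Z : Strand R} (hXY : X.Compat Y) (hZY : Z.Compat Y)
    (hXZ : X.Compat Z) (hX : Y.halfTurns X.vert < 0) (hZ : 0 < Y.halfTurns Z.vert) {c : ℝ}
    (hXs : X.start = Y.vert - exp c) (hXf : X.finish = Y.vert + exp c)
    (hZs : Z.start = Y.vert - exp c) (hZf : Z.finish = Y.vert + exp c)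
    (hXc : ∀ t, ‖X.path t - Y.vert‖ ≤ Real.exp c) (hZc : ∀ t, ‖Z.path t - Y.vert‖ ≤ Real.exp c) :
    Z.halfTurns X.vert = -1 := by
  have hXs' : Y.logLeft X.start = c := hXs ▸ logLeft_vert_sub_exp (hXs ▸ X.start_re_le)
  have hXf' : Y.logRight X.finish = c := hXf ▸ logRight_vert_add_exp (hXf ▸ X.le_finish_re)
  have hZs' : Y.logLeft Z.start = c := hZs ▸ logLeft_vert_sub_exp (hZs ▸ Z.start_re_le)
  have hZf' : Y.logRight Z.finish = c := hZf ▸ logRight_vert_add_exp (hZf ▸ Z.le_finish_re)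
  have hre : ∀ {z w : ℂ}, exp z = w → ‖w‖ ≤ Real.exp c → z.re ≤ c := fun hzw hw =>
    Real.exp_le_exp.1 (by rwa [← Complex.norm_exp, hzw])
  have hXc' := (forall_trans_iff (p := fun z => ‖z - Y.vert‖ ≤ Real.exp c)).1 hXc
  have hx : exp (Y.logRight X.vert) = X.vert - Y.vert :=
    exp_logRight (avoids_iff.1 hXY.symm.avoids).1
  have hne : ∀ t, exp ((liftα hZY).trans (liftβ hZY) t) ≠ exp (Y.logRight X.vert) :=
    fun t heq => hXZ.symm.avoids t (sub_left_inj.1 (by rw [← exp_lift hZY, heq, hx]))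
  have hZ_im : 0 < (Y.halfTurns Z.vert : ℝ) * π := mul_pos (by exact_mod_cast hZ) Real.pi_pos
  have hX_im : (Y.halfTurns X.vert : ℝ) * π < 0 :=
    mul_neg_of_neg_of_pos (by exact_mod_cast hX) Real.pi_pos
  have key := logVar_exp_path_sub_exp ((liftα hZY).trans (liftβ hZY)) (liftα hXY) (liftβ hXY)
    (fun t => hre (exp_lift hZY t) (hZc t)) (fun t => hre (exp_liftα hXY t) (hXc'.1 t))
    (fun t => hre (exp_liftβ hXY t) (hXc'.2 t)) (by simp [hZs']) (by simp [hXs']) hZf' hXf'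
    (by simpa [hZs'] using hZ_im) (by simpa [hXs'] using hX_im)
    (by rw [hZs', Complex.exp_add, exp_odd_mul_pi_mul_I (odd_halfTurns hZY.symm.avoids),
      mul_neg_one])
    hne (liftα_ne_lift hXY hZY hXZ (by omega)) (liftβ_eq_lift_of_exp_eq hXY hZY hXZ)
  simp only [exp_lift, hx, sub_sub_sub_cancel_right] at key
  have hfinish' : Z.finish - X.vert = exp c - (X.vert - Y.vert) := by rw [hZf]; ring
  have hstart' : X.vert - Z.start = exp c + (X.vert - Y.vert) := by rw [hZs]; ring
  apply halfTurns_of_turn_eq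
  rw [turn, key, hfinish', hstart']
  push_cast
  ring

theorem norm_path_extend_sub_le {X : Strand R} {a b y : ℂ} {ha : a.re ≤ -R} {hb : R ≤ b.re}
    {r : ℝ} (har : ‖a - y‖ ≤ r) (hbr : ‖b - y‖ ≤ r) (h : ∀ t, ‖X.path t - y‖ ≤ r) (t : I) :
    ‖(X.extend a b ha hb).path t - y‖ ≤ r := by
  have hball := convex_closedBall y r
  simp only [← mem_closedBall_iff_norm] at *
  have hX := (forall_trans_iff (p := (· ∈ Metric.closedBall y r))).1 h
  refine (forall_trans_iff (p := (· ∈ Metric.closedBall y r))).2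
    ⟨(forall_trans_iff (p := (· ∈ Metric.closedBall y r))).2 ⟨?_, hX.1⟩,
      (forall_trans_iff (p := (· ∈ Metric.closedBall y r))).2 ⟨hX.2, ?_⟩⟩ t
  · exact forall_path_segment_of_convex hball har (by simpa using hX.1 0)
  · exact forall_path_segment_of_convex hball (by simpa using hX.2 1) hbr

/-- With `Y.halfTurns X.vert < 0` read as `X` being below `Y`, this is transitivity. -/
theorem halfTurns_trans {X Y Z : Strand R} (hXY : X.Compat Y) (hZY : Z.Compat Y)
    (hXZ : X.Compat Z) (hX : Y.halfTurns X.vert < 0) (hZ : 0 < Y.halfTurns Z.vert) :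
    Z.halfTurns X.vert = -1 := by
  obtain ⟨c, hXc, hZc, hR⟩ := ((eventually_forall_norm_lt_exp
      (g := fun t => X.path t - Y.vert) (by fun_prop)).and <|
    (eventually_forall_norm_lt_exp (g := fun t => Z.path t - Y.vert) (by fun_prop)).and <|
      Real.tendsto_exp_atTop.eventually_ge_atTop (2 * R)).exists
  have ha : (Y.vert - exp c).re ≤ -R := by
    rw [← Complex.ofReal_exp, Complex.sub_re, Complex.ofReal_re]; linarith [Y.vert_re_lt]
  have hb : R ≤ (Y.vert + exp c).re := by
    rw [← Complex.ofReal_exp, Complex.add_re, Complex.ofReal_re]; linarith [Y.lt_vert_re]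
  have hac : ‖Y.vert - exp c - Y.vert‖ ≤ Real.exp c := by
    rw [sub_sub_cancel_left, norm_neg, Complex.norm_exp, Complex.ofReal_re]
  have hbc : ‖Y.vert + exp c - Y.vert‖ ≤ Real.exp c := by
    rw [add_sub_cancel_left, Complex.norm_exp, Complex.ofReal_re]
  rw [← halfTurns_extend (ha := ha) (hb := hb) hXZ.symm.avoids X.lt_vert_re X.vert_re_lt]
  exact halfTurns_trans_of_ends (X := X.extend _ _ ha hb) (Z := Z.extend _ _ ha hb)
    (hXY.extend ha hb) (hZY.extend ha hb) ((hXZ.extend ha hb).symm.extend ha hb).symm hX hZ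
    rfl rfl rfl rfl (norm_path_extend_sub_le hac hbc fun t => (hXc t).le)
    (norm_path_extend_sub_le hac hbc fun t => (hZc t).le)

end Strand

/-! ### Periodicity -/

theorem not_of_add_of_eventually_not {P : ℤ → Prop} (hadd : ∀ k l, P k → P l → P (k + l))
    (htop : ∀ᶠ k in .atTop, ¬P k) {k : ℤ} (hk : 0 < k) : ¬P k := fun hPk => by
  have hmul : ∀ n : ℕ, P ((n + 1) * k) := fun n => by
    induction n with
    | zero => simpa using hPk
    | succ n ih =>
      rw [Nat.cast_succ, add_one_mul]
      exact hadd _ _ ih hPk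
  obtain ⟨K, hK⟩ := Filter.eventually_atTop.1 htop
  refine hK _ ?_ (hmul K.toNat)
  nlinarith [K.self_le_toNat]

theorem eq_one_or_eq_neg_one_of_reflection {A : ℤ → ℤ} {d : ℤ} (h0 : ∀ k, A k ≠ 0)
    (hneg : ∀ k l, A k < 0 → A l < 0 → A (k + l) < 0)
    (hpos : ∀ k l, 0 < A k → 0 < A l → 0 < A (k + l))
    (htop : ∀ᶠ k in .atTop, 0 < A k) (hbot : ∀ᶠ k in .atBot, A k < 0)
    (hrefl : ∀ k, A (k + d) = -A (-k)) : d = 1 ∨ d = -1 := by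
  have A_pos : ∀ k > 0, 0 < A k := fun k hk => (h0 k).lt_or_gt.resolve_left <|
    not_of_add_of_eventually_not hneg (htop.mono fun _ h => h.not_gt) hk
  have A_neg : ∀ k > 0, A (-k) < 0 := fun k hk => (h0 (-k)).lt_or_gt.resolve_right <|
    not_of_add_of_eventually_not (P := fun k => 0 < A (-k))
      (fun k l hk hl => by rw [neg_add]; exact hpos _ _ hk hl)
      ((Filter.tendsto_neg_atTop_atBot.eventually hbot).mono fun _ h => h.not_gt) hk
  by_contra! hd
  rcases lt_trichotomy d 0 with hlt | rfl | hgt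
  · have hleft := A_neg (-(1 + d)) (by omega)
    have hright := A_neg 1 one_pos
    rw [neg_neg, hrefl] at hleft
    omega
  · have := hrefl 0
    have := h0 0
    simp only [add_zero, neg_zero] at *
    omega
  · have hleft := A_pos (-1 + d) (by omega)
    have hright := A_pos 1 one_pos
    rw [hrefl, neg_neg] at hleft
    omega

theorem exp_add_int_mul_two_pi_mul_I (z : ℂ) (k : ℤ) :
    exp (z + k * (2 * π * Complex.I)) = exp z := by
  rw [Complex.exp_add, Complex.exp_int_mul_two_pi_mul_I, mul_one]

namespace Strand

variable {R : ℝ}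

/-- All translates of the two strands by multiples of `2πi` are compatible. -/
def PeriodicCompat (X Y : Strand R) : Prop :=
  (∀ s t, exp (X.α s) ≠ exp (Y.β t)) ∧ ∀ s t, exp (Y.α s) ≠ exp (X.β t)

theorem PeriodicCompat.symm {X Y : Strand R} (h : X.PeriodicCompat Y) : Y.PeriodicCompat X :=
  ⟨h.2, h.1⟩

theorem PeriodicCompat.compat {X Y : Strand R} (h : X.PeriodicCompat Y) : X.Compat Y :=
  ⟨fun s t heq => h.1 s t (by rw [heq]), fun s t heq => h.2 s t (by rw [heq])⟩

theorem exp_shift_α (X : Strand R) (k : ℤ) (t : I) : exp ((X.shift k).α t) = exp (X.α t) :=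
  exp_add_int_mul_two_pi_mul_I _ k

theorem exp_shift_β (X : Strand R) (k : ℤ) (t : I) : exp ((X.shift k).β t) = exp (X.β t) :=
  exp_add_int_mul_two_pi_mul_I _ k

theorem PeriodicCompat.shift_right {X Y : Strand R} (h : X.PeriodicCompat Y) (k : ℤ) :
    X.PeriodicCompat (Y.shift k) :=
  ⟨fun s t => by rw [exp_shift_β]; exact h.1 s t, fun s t => by rw [exp_shift_α]; exact h.2 s t⟩

theorem PeriodicCompat.shift_left {X Y : Strand R} (h : X.PeriodicCompat Y) (k : ℤ) :
    (X.shift k).PeriodicCompat Y :=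
  (h.symm.shift_right k).symm

theorem PeriodicCompat.halfTurns_antisymm {X Y : Strand R} (h : X.PeriodicCompat Y) (k : ℤ) :
    X.halfTurns (Y.vert + k * (2 * π * Complex.I)) =
      -Y.halfTurns (X.vert + (-k : ℤ) * (2 * π * Complex.I)) := by
  have hanti := Strand.halfTurns_antisymm (h.shift_right k).compat
  rw [halfTurns_shift] at hanti
  rw [Int.cast_neg, neg_mul, ← sub_eq_add_neg, ← hanti, shift_vert]

theorem PeriodicCompat.halfTurns_ne_zero {X Y : Strand R} (h : X.PeriodicCompat Y) (k : ℤ) :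
    X.halfTurns (Y.vert + k * (2 * π * Complex.I)) ≠ 0 :=
  Strand.halfTurns_ne_zero (h.shift_right k).compat.avoids

theorem PeriodicCompat.halfTurns_trans {X Y Z : Strand R} (hXY : X.PeriodicCompat Y)
    (hZY : Z.PeriodicCompat Y) (hXZ : X.PeriodicCompat Z) {j k : ℤ}
    (hX : Y.halfTurns (X.vert + j * (2 * π * Complex.I)) < 0)
    (hZ : 0 < Y.halfTurns (Z.vert + k * (2 * π * Complex.I))) :
    Z.halfTurns (X.vert + (j - k : ℤ) * (2 * π * Complex.I)) = -1 := by
  have htrans := Strand.halfTurns_trans (hXY.shift_left j).compat (hZY.shift_left k).compat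
    ((hXZ.shift_left j).shift_right k).compat hX hZ
  rwa [halfTurns_shift, shift_vert, add_sub_assoc, ← sub_mul, ← Int.cast_sub] at htrans

/-- The points `p` and `q` are joined by a path in the strip `|re| < R` off all translates of the
strand by multiples of `2πi`. -/
def JoinedOff (X : Strand R) (p q : ℂ) : Prop :=
  ∃ γ : Path p q, (∀ t, -R < (γ t).re) ∧ (∀ t, (γ t).re < R) ∧
    ∀ s t, exp (X.path s) ≠ exp (γ t)

theorem JoinedOff.halfTurns_eq {X : Strand R} {p q : ℂ} (h : X.JoinedOff p q) (k : ℤ) :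
    X.halfTurns (p + k * (2 * π * Complex.I)) = X.halfTurns (q + k * (2 * π * Complex.I)) := by
  obtain ⟨γ, hl, hr, hoff⟩ := h
  refine X.halfTurns_eq_of_path (γ.map (f := (· + k * (2 * π * Complex.I))) (by fun_prop))
    (fun t => by simpa using hl t) (fun t => by simpa using hr t) fun t s heq => hoff s t ?_
  rw [heq]
  exact exp_add_int_mul_two_pi_mul_I _ k

theorem period_eq_one_or_neg_one {X Y Z : Strand R} (hXY : X.PeriodicCompat Y)
    (hYZ : Y.PeriodicCompat Z) (hZX : Z.PeriodicCompat X) {d : ℤ}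
    (hX : X.JoinedOff Y.vert Z.vert) (hZ : Z.JoinedOff X.vert Y.vert)
    (hY : Y.JoinedOff Z.vert (X.vert + d * (2 * π * Complex.I))) : d = 1 ∨ d = -1 := by
  let A : ℤ → ℤ := fun k => Y.halfTurns (X.vert + k * (2 * π * Complex.I))
  have hXZ_eq : ∀ k : ℤ, X.halfTurns (Z.vert + k * (2 * π * Complex.I)) = -A (-k) := fun k => by
    rw [← hX.halfTurns_eq, hXY.halfTurns_antisymm]
  have hZX_eq : ∀ k : ℤ, Z.halfTurns (X.vert + k * (2 * π * Complex.I)) = A k := fun k => by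
    rw [hZX.halfTurns_antisymm, hXZ_eq, neg_neg, neg_neg]
  have hYZ_eq : ∀ k : ℤ, Y.halfTurns (Z.vert + k * (2 * π * Complex.I)) = -A (-k) := fun k => by
    rw [hYZ.halfTurns_antisymm, ← hZ.halfTurns_eq, hZX_eq]
  have hrefl : ∀ k : ℤ, A (k + d) = -A (-k) := fun k => by
    rw [← hYZ_eq, hY.halfTurns_eq, add_assoc, ← add_mul, ← Int.cast_add, add_comm d]
  refine eq_one_or_eq_neg_one_of_reflection hXY.symm.halfTurns_ne_zero (fun k l hk hl => ?_)
    (fun k l hk hl => ?_) ?_ ?_ hrefl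
  · have htrans := hXY.halfTurns_trans hYZ.symm hZX.symm (k := -l) hk
      (by rw [hYZ_eq, neg_neg]; exact neg_pos.2 hl)
    rw [hZX_eq, sub_neg_eq_add] at htrans
    exact htrans.trans_lt neg_one_lt_zero
  · have htrans := hYZ.symm.halfTurns_trans hXY hZX (j := -l) (k := k)
      (by rw [hYZ_eq, neg_neg]; exact neg_neg_iff_pos.2 hl) hk
    rw [hXZ_eq, neg_sub, sub_neg_eq_add, neg_inj] at htrans
    exact one_pos.trans_eq htrans.symm
  · exact (Y.eventually_halfTurns_eq_one X.lt_vert_re X.vert_re_lt).mono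
      fun k hk => hk ▸ one_pos
  · exact (Y.eventually_halfTurns_eq_neg_one X.lt_vert_re X.vert_re_lt).mono
      fun k hk => hk ▸ neg_one_lt_zero

end Strand

/-! ### Marked paths -/

/-- The Möbius transformation that takes `A` to `0` and `B` to `∞`. -/
def ratio (A B p : ℂ) : ℂ := (p - A) / (p - B)

theorem ratio_self_left (A B : ℂ) : ratio A B A = 0 := by rw [ratio, sub_self, zero_div]

theorem ratio_ne_zero {A B p : ℂ} (hA : p ≠ A) (hB : p ≠ B) : ratio A B p ≠ 0 :=
  div_ne_zero (sub_ne_zero.2 hA) (sub_ne_zero.2 hB)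

theorem inv_ratio (A B p : ℂ) : (ratio A B p)⁻¹ = ratio B A p := inv_div _ _

theorem injOn_ratio {A B : ℂ} (hAB : A ≠ B) : Set.InjOn (ratio A B) {B}ᶜ := by
  intro p hp q hq heq
  rw [ratio, ratio, div_eq_div_iff (sub_ne_zero.2 hp) (sub_ne_zero.2 hq)] at heq
  have hmul : (p - q) * (A - B) = 0 := by linear_combination heq
  exact sub_eq_zero.1 ((mul_eq_zero.1 hmul).resolve_right (sub_ne_zero.2 hAB))

theorem continuous_ratio {A B : ℂ} {g : I → ℂ} (hg : Continuous g) (h : ∀ t, g t ≠ B) :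
    Continuous fun t => ratio A B (g t) :=
  (hg.sub continuous_const).div (hg.sub continuous_const) fun t => sub_ne_zero.2 (h t)

/-- The reparametrization starts just after the last zero of `g`. -/
theorem exists_truncation {g : I → ℂ} (hg : Continuous g) (h0 : g 0 = 0) (h1 : g 1 ≠ 0) {ε : ℝ}
    (hε : 0 < ε) : ∃ r : I → I, Continuous r ∧ r 1 = 1 ∧ (∀ t, g (r t) ≠ 0) ∧ ‖g (r 0)‖ < ε := by
  obtain ⟨m, hm, hmax⟩ :=
    (isClosed_singleton.preimage hg).isCompact.exists_isGreatest (s := {t | g t = 0}) ⟨0, h0⟩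
  have hm1 : m < 1 := le_one'.lt_of_ne fun h => h1 (h ▸ hm)
  have : (nhdsWithin m (Set.Ioi m)).NeBot := nhdsGT_neBot_of_exists_gt ⟨1, hm1⟩
  have hsmall : ∀ᶠ t in nhdsWithin m (Set.Ioi m), ‖g t‖ < ε :=
    ((hg.norm.tendsto' m 0 (norm_eq_zero.2 hm)).mono_left nhdsWithin_le_nhds).eventually_lt_const hε
  obtain ⟨a, ha, hma⟩ := (hsmall.and self_mem_nhdsWithin).exists
  exact ⟨fun t => max a t, by fun_prop, max_eq_right le_one',
    fun t ht => (le_max_left a t).not_gt ((hmax ht).trans_lt hma), by simpa using ha⟩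

theorem exists_lift_from_left {A B v : ℂ} {γ : Path A v} (hB : ∀ t, γ t ≠ B) {R : ℝ}
    (hR : ∀ t, ‖ratio A B (γ t)‖ < Real.exp R) {L : ℂ} (hL : exp L = ratio A B v) :
    ∃ z, z.re ≤ -R ∧ ∃ l : Path z L,
      (∀ t, (l t).re < R) ∧ ∀ t, ∃ s, exp (l t) = ratio A B (γ s) := by
  have hg : Continuous fun t => ratio A B (γ t) := continuous_ratio γ.continuous hB
  obtain ⟨r, hr, hr1, hr_ne, hr0⟩ := exists_truncation hg (by simp [ratio_self_left])
    (by rw [γ.target, ← hL]; exact Complex.exp_ne_zero L) (Real.exp_pos (-R))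
  obtain ⟨l, hl, hexp, hl1⟩ := exists_continuous_log_of_exp_eq
    (g := fun t => ratio A B (γ (r (σ t)))) (hg.comp (hr.comp continuous_symm))
    (fun t => hr_ne _) (w := L) (by rw [symm_zero, hr1, γ.target, hL])
  refine ⟨l 1, ?_, Path.symm ⟨⟨l, hl⟩, hl1, rfl⟩, fun t => ?_, fun t => ⟨_, hexp (σ t)⟩⟩
  · have hnorm : ‖exp (l 1)‖ < Real.exp (-R) := by rwa [hexp, symm_one]
    rw [Complex.norm_exp, Real.exp_lt_exp] at hnorm
    exact hnorm.le
  · have hnorm : ‖exp (l (σ t))‖ < Real.exp R := by rw [hexp]; exact hR _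
    rwa [Complex.norm_exp, Real.exp_lt_exp] at hnorm

/-- A path from `A` to `B` with a marked point `vert`, which cuts it into the paths `α` and `β`;
the first one does not pass through `B`, the second one does not pass through `A`. -/
structure MarkedPath (A B : ℂ) where
  {vert : ℂ}
  α : Path A vert
  β : Path vert B
  α_ne : ∀ t, α t ≠ B
  β_ne : ∀ t, β t ≠ A

namespace MarkedPath

variable {A B : ℂ} {R : ℝ}

/-- Both parts of the marked path lie over the strip `|re| < R` except near the ends `A` and `B`
of the marked path. -/
def Bounded (P : MarkedPath A B) (R : ℝ) : Prop :=
  (∀ t, ‖ratio A B (P.α t)‖ < Real.exp R) ∧ ∀ t, ‖ratio B A (P.β t)‖ < Real.exp R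

theorem eventually_bounded (P : MarkedPath A B) : ∀ᶠ R in Filter.atTop, P.Bounded R :=
  (eventually_forall_norm_lt_exp (continuous_ratio P.α.continuous P.α_ne)).and
    (eventually_forall_norm_lt_exp (continuous_ratio P.β.continuous P.β_ne))

/-- Up to parts near the ends, the strand `X` is a logarithm of the image of the marked path `P`
under the Möbius transformation `ratio A B`. -/
def IsLift (P : MarkedPath A B) (X : Strand R) : Prop :=
  (∀ t, ∃ s, exp (X.α t) = ratio A B (P.α s)) ∧
    ∀ t, ∃ s, P.β s ≠ B ∧ exp (X.β t) = ratio A B (P.β s)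

theorem exists_isLift (P : MarkedPath A B) (hP : P.Bounded R) {L : ℂ}
    (hL : exp L = ratio A B P.vert) : ∃ X : Strand R, X.vert = L ∧ P.IsLift X := by
  obtain ⟨z, hz, l, hl, hexp⟩ := exists_lift_from_left P.α_ne hP.1 hL
  obtain ⟨w, hw, m, hm, hexp'⟩ := exists_lift_from_left (γ := P.β.symm) (L := -L)
    (fun t => P.β_ne _) (fun t => hP.2 _) (by rw [Complex.exp_neg, hL, inv_ratio])
  let β : Path L (-w) := (m.map continuous_neg).symm.cast (neg_neg L).symm rfl
  refine ⟨⟨l, β, hz, ?_, hl, fun t => ?_⟩, rfl, hexp, fun t => ?_⟩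
  · rw [Complex.neg_re]
    linarith
  · change -R < (-m (σ t)).re
    rw [Complex.neg_re]
    linarith [hm (σ t)]
  · obtain ⟨s, hs⟩ := hexp' (σ t)
    refine ⟨σ s, fun heq => Complex.exp_ne_zero (m (σ t)) ?_, ?_⟩
    · rw [hs, Path.symm_apply, Function.comp_apply, heq, ratio_self_left]
    · change exp (-m (σ t)) = _
      rw [Complex.exp_neg, hs, inv_ratio, Path.symm_apply, Function.comp_apply]

/-- The first part of each of two marked paths is disjoint from the second part of the other
one. -/
def Compat (P Q : MarkedPath A B) : Prop := (∀ s t, P.α s ≠ Q.β t) ∧ ∀ s t, Q.α s ≠ P.β t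

theorem IsLift.exp_α_ne {P : MarkedPath A B} {X : Strand R} (hX : P.IsLift X) (hAB : A ≠ B)
    {z p : ℂ} (hz : exp z = ratio A B p) (hpB : p ≠ B) (hp : ∀ s, P.α s ≠ p) (s : I) :
    exp (X.α s) ≠ exp z := by
  obtain ⟨s', hs⟩ := hX.1 s
  rw [hs, hz]
  exact (injOn_ratio hAB).ne (P.α_ne s') hpB (hp s')

theorem IsLift.exp_β_ne {P : MarkedPath A B} {X : Strand R} (hX : P.IsLift X) (hAB : A ≠ B)
    {z p : ℂ} (hz : exp z = ratio A B p) (hpB : p ≠ B) (hp : ∀ s, P.β s ≠ p) (s : I) :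
    exp (X.β s) ≠ exp z := by
  obtain ⟨s', hsB, hs⟩ := hX.2 s
  rw [hs, hz]
  exact (injOn_ratio hAB).ne hsB hpB (hp s')

theorem IsLift.periodicCompat {P Q : MarkedPath A B} {X Y : Strand R} (hX : P.IsLift X)
    (hY : Q.IsLift Y) (hAB : A ≠ B) (h : P.Compat Q) : X.PeriodicCompat Y :=
  ⟨fun s t => let ⟨t', htB, ht⟩ := hY.2 t; hX.exp_α_ne hAB ht htB (fun s => h.1 s t') s,
    fun s t => let ⟨t', htB, ht⟩ := hX.2 t; hY.exp_α_ne hAB ht htB (fun s => h.2 s t') s⟩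

/-- The path `γ` joins the marked points of `P` and `Q` off `A`, `B` and the marked path `S`. -/
structure IsSide (P Q S : MarkedPath A B) (γ : Path P.vert Q.vert) : Prop where
  ne_left : ∀ t, γ t ≠ A
  ne_right : ∀ t, γ t ≠ B
  α_ne : ∀ s t, S.α s ≠ γ t
  β_ne : ∀ s t, S.β s ≠ γ t

namespace IsSide

variable {P Q S : MarkedPath A B} {γ : Path P.vert Q.vert}

theorem ratio_ne_zero (h : IsSide P Q S γ) (t : I) : ratio A B (γ t) ≠ 0 :=
  _root_.ratio_ne_zero (h.ne_left t) (h.ne_right t)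

theorem continuous_ratio (h : IsSide P Q S γ) : Continuous fun t => ratio A B (γ t) :=
  _root_.continuous_ratio γ.continuous h.ne_right

theorem logVar_ratio (h : IsSide P Q S γ) : logVar (fun t => ratio A B (γ t)) =
    logVar (fun t => γ t - A) - logVar fun t => γ t - B :=
  logVar_div (by fun_prop) (fun t => sub_ne_zero.2 (h.ne_left t)) (by fun_prop)
    fun t => sub_ne_zero.2 (h.ne_right t)

theorem exp_add_logVar (h : IsSide P Q S γ) {L : ℂ} (hL : exp L = ratio A B P.vert) :
    exp (L + logVar fun t => ratio A B (γ t)) = ratio A B Q.vert := by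
  have h0 : ratio A B P.vert ≠ 0 := by simpa using h.ratio_ne_zero 0
  rw [Complex.exp_add, exp_logVar h.continuous_ratio h.ratio_ne_zero, hL, γ.source, γ.target,
    mul_div_cancel₀ _ h0]

theorem eventually_bounded (h : IsSide P Q S γ) : ∀ᶠ R in Filter.atTop,
    (∀ t, ‖ratio A B (γ t)‖ < Real.exp R) ∧ ∀ t, ‖ratio B A (γ t)‖ < Real.exp R :=
  (eventually_forall_norm_lt_exp h.continuous_ratio).and
    (eventually_forall_norm_lt_exp (_root_.continuous_ratio γ.continuous h.ne_left))

theorem joinedOff (h : IsSide P Q S γ) (hAB : A ≠ B)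
    (hR : (∀ t, ‖ratio A B (γ t)‖ < Real.exp R) ∧ ∀ t, ‖ratio B A (γ t)‖ < Real.exp R)
    {Z : Strand R} (hZ : S.IsLift Z) {L : ℂ} (hL : exp L = ratio A B P.vert) :
    Z.JoinedOff L (L + logVar fun t => ratio A B (γ t)) := by
  obtain ⟨l, hl, hexp, hl0⟩ := exists_continuous_log_of_exp_eq h.continuous_ratio h.ratio_ne_zero
    (w := L) (by rw [hL, γ.source])
  refine ⟨⟨⟨l, hl⟩, hl0, ?_⟩, fun t => ?_, fun t => ?_, fun s t => ?_⟩
  · rw [logVar_eq hl hexp, hl0]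
    exact (add_sub_cancel L (l 1)).symm
  · have hnorm := hR.2 t
    rw [← inv_ratio, ← hexp, ← Complex.exp_neg, Complex.norm_exp, Real.exp_lt_exp,
      Complex.neg_re] at hnorm
    exact neg_lt.1 hnorm
  · have hnorm := hR.1 t
    rwa [← hexp, Complex.norm_exp, Real.exp_lt_exp] at hnorm
  · exact (forall_trans_iff (p := fun z => exp z ≠ exp (l t))).2
      ⟨hZ.exp_α_ne hAB (hexp t) (h.ne_right t) fun s => h.α_ne s t,
        hZ.exp_β_ne hAB (hexp t) (h.ne_right t) fun s => h.β_ne s t⟩ s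

end IsSide

theorem exists_logVar_triangle_eq (hAB : A ≠ B) {P Q S : MarkedPath A B} (hPQ : P.Compat Q)
    (hQS : Q.Compat S) (hSP : S.Compat P) {γ₁ : Path P.vert Q.vert} {γ₂ : Path Q.vert S.vert}
    {γ₃ : Path S.vert P.vert} (h₁ : IsSide P Q S γ₁) (h₂ : IsSide Q S P γ₂)
    (h₃ : IsSide S P Q γ₃) :
    ∃ d : ℤ, (d = 1 ∨ d = -1) ∧
      (logVar (fun t => γ₁ t - A) + (logVar (fun t => γ₂ t - A) + logVar fun t => γ₃ t - A)) -
        (logVar (fun t => γ₁ t - B) + (logVar (fun t => γ₂ t - B) + logVar fun t => γ₃ t - B)) =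
      d * (2 * π * Complex.I) := by
  obtain ⟨R, hP, hQ, hS, hγ₁, hγ₂, hγ₃⟩ := (P.eventually_bounded.and <|
    Q.eventually_bounded.and <| S.eventually_bounded.and <| h₁.eventually_bounded.and <|
    h₂.eventually_bounded.and h₃.eventually_bounded).exists
  have hL : exp (log (ratio A B P.vert)) = ratio A B P.vert :=
    Complex.exp_log (by simpa using h₁.ratio_ne_zero 0)
  have hL₁ := h₁.exp_add_logVar hL
  have hL₂ := h₂.exp_add_logVar hL₁
  have hL₃ := h₃.exp_add_logVar hL₂
  obtain ⟨X, hXL, hX⟩ := P.exists_isLift hP hL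
  obtain ⟨Y, hYL, hY⟩ := Q.exists_isLift hQ hL₁
  obtain ⟨Z, hZL, hZ⟩ := S.exists_isLift hS hL₂
  have side₁ := h₁.joinedOff hAB hγ₁ hZ hL
  have side₂ := h₂.joinedOff hAB hγ₂ hX hL₁
  have side₃ := h₃.joinedOff hAB hγ₃ hY hL₂
  obtain ⟨d, hd⟩ := Complex.exp_eq_exp_iff_exists_int.1 (hL₃.trans hL.symm)
  rw [← hYL, ← hXL] at side₁
  rw [← hZL, ← hYL] at side₂
  rw [hd, ← hZL, ← hXL] at side₃
  rw [h₁.logVar_ratio, h₂.logVar_ratio, h₃.logVar_ratio] at hd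
  exact ⟨d, Strand.period_eq_one_or_neg_one (hX.periodicCompat hY hAB hPQ)
    (hY.periodicCompat hZ hAB hQS) (hZ.periodicCompat hX hAB hSP) side₂ side₁ side₃,
    by linear_combination hd⟩

end MarkedPath

/-! ### Polygonal lines -/

/-- The polygonal line with the ends `a` and `b` and the list `l` of intermediate vertices, as a
path. -/
def polygonalPath : (l : List ℂ) → (a b : ℂ) → Path a b
  | [], a, b => Path.segment a b
  | c :: l, a, b => (Path.segment a c).trans (polygonalPath l c b)

theorem polygonalImage_pair (a b : ℂ) : polygonalImage [a, b] = segment ℝ a b := by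
  simp [polygonalImage]

theorem polygonalImage_cons_cons (a b : ℂ) (l : List ℂ) :
    polygonalImage (a :: b :: l) = segment ℝ a b ∪ polygonalImage (b :: l) := by
  ext x
  simp [polygonalImage]

theorem range_polygonalPath (l : List ℂ) (a b : ℂ) :
    Set.range (polygonalPath l a b) = polygonalImage (a :: (l ++ [b])) := by
  induction l generalizing a with
  | nil => exact (Path.range_segment a b).trans (polygonalImage_pair a b).symm
  | cons c l ih =>
    rw [polygonalPath, Path.trans_range, ih, Path.range_segment, List.cons_append,
      polygonalImage_cons_cons]

/-- The sum of the oriented angles `∠A₁OA₂, …, ∠A_{m-1}OA_m` of a polygonal line. -/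
def polygonalAngle (l : List ℂ) (O : ℂ) : ℝ :=
  (List.zipWith (fun A B => orientedAngle A O B) l l.tail).sum

theorem polygonalAngle_singleton (a O : ℂ) : polygonalAngle [a] O = 0 := rfl

theorem polygonalAngle_cons_cons (a b : ℂ) (l : List ℂ) (O : ℂ) :
    polygonalAngle (a :: b :: l) O = orientedAngle a O b + polygonalAngle (b :: l) O := by
  simp [polygonalAngle]

theorem polygonalAngle_append (l m : List ℂ) (a b O : ℂ) :
    polygonalAngle (a :: (l ++ b :: m)) O =
      polygonalAngle (a :: (l ++ [b])) O + polygonalAngle (b :: m) O := by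
  induction l generalizing a with
  | nil =>
    simp only [List.nil_append, polygonalAngle_cons_cons, polygonalAngle_singleton, add_zero]
  | cons c l ih => simp only [List.cons_append, polygonalAngle_cons_cons, ih, add_assoc]

theorem polygonalWinding_cons (a : ℂ) (l : List ℂ) (O : ℂ) :
    polygonalWinding (a :: l) O = polygonalAngle (a :: (l ++ [a])) O / (2 * π) := by
  rw [polygonalWinding, polygonalAngle, List.rotate_cons_succ, List.rotate_zero, List.tail_cons,
    ← List.cons_append, List.zipWith_eq_zipWith_take_min (l₁ := a :: l ++ [a])]
  simp [List.take_of_length_le]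

theorem div_mem_slitPlane_of_notMem_segment {a b p O : ℂ} (h : O ∉ segment ℝ a b)
    (hp : p ∈ segment ℝ a b) : (p - O) / (a - O) ∈ slitPlane := by
  have ha : a - O ≠ 0 := sub_ne_zero.2 fun heq => h (heq ▸ left_mem_segment ℝ a b)
  by_contra hslit
  rw [Complex.mem_slitPlane_iff, not_or, not_lt, not_not] at hslit
  obtain ⟨r, hr⟩ : ∃ r : ℝ, (p - O) / (a - O) = r := ⟨_, Complex.ext rfl hslit.2⟩
  have hneg : 0 ≤ -r := by simpa [hr] using hslit.1
  have hsub : p - O = -r • (O - a) := by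
    rw [div_eq_iff ha] at hr
    rw [hr, Complex.real_smul, Complex.ofReal_neg]
    ring
  refine h ((convex_segment a b).segment_subset (left_mem_segment ℝ a b) hp ?_)
  rw [mem_segment_iff_sameRay, hsub]
  exact SameRay.sameRay_nonneg_smul_right _ hneg

theorem im_logVar_segment_sub {a b O : ℂ} (h : O ∉ segment ℝ a b) :
    (logVar fun t => Path.segment a b t - O).im = orientedAngle a O b := by
  have hmem : ∀ t, Path.segment a b t ∈ segment ℝ a b := fun t =>
    Path.range_segment a b ▸ Set.mem_range_self t
  have hne : ∀ t, Path.segment a b t - O ≠ 0 := fun t =>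
    sub_ne_zero.2 fun heq => h (heq ▸ hmem t)
  have ha : a - O ≠ 0 := by simpa using hne 0
  rw [← logVar_const_mul (inv_ne_zero ha) (by fun_prop) hne,
    logVar_of_mem_slitPlane (by fun_prop) fun t => by
      rw [inv_mul_eq_div]; exact div_mem_slitPlane_of_notMem_segment h (hmem t),
    Path.source, Path.target, inv_mul_cancel₀ ha, Complex.log_one, sub_zero, Complex.log_im,
    orientedAngle, inv_mul_eq_div]

theorem im_logVar_polygonalPath_sub {l : List ℂ} {a b O : ℂ}
    (h : O ∉ polygonalImage (a :: (l ++ [b]))) :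
    (logVar fun t => polygonalPath l a b t - O).im = polygonalAngle (a :: (l ++ [b])) O := by
  induction l generalizing a with
  | nil =>
    rw [List.nil_append, polygonalImage_pair] at h
    rw [polygonalPath, im_logVar_segment_sub h, List.nil_append, polygonalAngle_cons_cons,
      polygonalAngle_singleton, add_zero]
  | cons c l ih =>
    rw [List.cons_append, polygonalImage_cons_cons, Set.mem_union, not_or] at h
    rw [polygonalPath, logVar_path_trans, Complex.add_im, im_logVar_segment_sub h.1, ih h.2,
      List.cons_append, polygonalAngle_cons_cons]
    · exact fun t heq => h.1 (Path.range_segment a c ▸ ⟨t, heq⟩)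
    · exact fun t heq => h.2 (range_polygonalPath l c b ▸ ⟨t, heq⟩)

namespace PLMap

variable {V : Type*} {G : SimpleGraph V}

/-- The restriction of the map to an oriented edge, as a continuous path. -/
def path (f : PLMap G) (d : G.Dart) : Path (f.pos d.fst) (f.pos d.snd) :=
  polygonalPath (f.inner d) (f.pos d.fst) (f.pos d.snd)

theorem path_mem_edgeImage (f : PLMap G) (d : G.Dart) (t : I) : f.path d t ∈ f.edgeImage d :=
  (range_polygonalPath _ _ _).subset (Set.mem_range_self t)

theorem path_ne {f : PLMap G} {d : G.Dart} {O : ℂ} (h : O ∉ f.edgeImage d) (t : I) :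
    f.path d t ≠ O := fun heq => h (heq ▸ f.path_mem_edgeImage d t)

theorem im_logVar_path_sub (f : PLMap G) {d : G.Dart} {O : ℂ} (h : O ∉ f.edgeImage d) :
    (logVar fun t => f.path d t - O).im = polygonalAngle (f.line d) O :=
  im_logVar_polygonalPath_sub h

theorem exp_logVar_path_sub_mul (f : PLMap G) {d : G.Dart} {O : ℂ} (h : O ∉ f.edgeImage d) :
    exp (logVar fun t => f.path d t - O) * (f.pos d.fst - O) = f.pos d.snd - O := by
  have hne : ∀ t, f.path d t - O ≠ 0 := fun t => sub_ne_zero.2 (path_ne h t)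
  rw [exp_logVar (by fun_prop) hne, Path.source, Path.target]
  exact div_mul_cancel₀ _ (by simpa using hne 0)

theorem exp_sum_logVar_path_sub_mul (f : PLMap G) {O : ℂ} {u v : V} (W : G.Walk u v)
    (h : ∀ d ∈ W.darts, O ∉ f.edgeImage d) :
    exp (W.darts.map fun d => logVar fun t => f.path d t - O).sum * (f.pos u - O) =
      f.pos v - O := by
  induction W with
  | nil => simp
  | cons hadj W ih =>
    rw [SimpleGraph.Walk.darts_cons, List.forall_mem_cons] at h
    rw [SimpleGraph.Walk.darts_cons, List.map_cons, List.sum_cons, add_comm, Complex.exp_add,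
      mul_assoc, f.exp_logVar_path_sub_mul h.1, ih h.2]

theorem exists_polygonalAngle_walk_eq (f : PLMap G) (O : ℂ) {u v : V} (W : G.Walk u v) :
    ∃ l, (W.darts.flatMap fun d => (f.line d).dropLast) ++ [f.pos v] = f.pos u :: l ∧
      polygonalAngle (f.pos u :: l) O = (W.darts.map fun d => polygonalAngle (f.line d) O).sum := by
  induction W with
  | nil => exact ⟨[], by simp, rfl⟩
  | @cons u w v hadj W ih =>
    obtain ⟨l, hl, hangle⟩ := ih
    refine ⟨f.inner ⟨(u, w), hadj⟩ ++ f.pos w :: l, ?_, ?_⟩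
    · rw [SimpleGraph.Walk.darts_cons, List.flatMap_cons, List.append_assoc, hl, line,
        ← List.cons_append, List.dropLast_concat, List.cons_append]
    · rw [polygonalAngle_append, hangle, SimpleGraph.Walk.darts_cons, List.map_cons,
        List.sum_cons, line]

theorem polygonalWinding_closedLine (f : PLMap G) (O : ℂ) {v : V} (C : G.Walk v v) :
    polygonalWinding (f.closedLine C) O =
      (C.darts.map fun d => polygonalAngle (f.line d) O).sum / (2 * π) := by
  obtain ⟨l, hl, hangle⟩ := f.exists_polygonalAngle_walk_eq O C
  change f.closedLine C ++ [f.pos v] = f.pos v :: l at hl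
  rw [← hangle, ← hl]
  rcases hC : f.closedLine C with _ | ⟨a, m⟩
  · simp [polygonalWinding, polygonalAngle_singleton]
  · obtain rfl : a = f.pos v := by simpa [hC] using congrArg List.head? hl
    rw [polygonalWinding_cons, List.cons_append]

theorem exists_int_winding_eq (f : PLMap G) {u v : V} {C : G.Walk v v}
    (h : f.pos u ∉ f.cycleImage C) :
    ∃ w : ℤ, f.winding C u = w ∧
      (C.darts.map fun d => logVar fun t => f.path d t - f.pos u).sum =
        w * (2 * π * Complex.I) := by
  have hoff : ∀ d ∈ C.darts, f.pos u ∉ f.edgeImage d := fun d hd hmem => h ⟨d, hd, hmem⟩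
  have hexp : exp (C.darts.map fun d => logVar fun t => f.path d t - f.pos u).sum = 1 := by
    cases C with
    | nil => simp
    | cons hadj W =>
      have hne : f.pos v ≠ f.pos u := by
        simpa using path_ne (hoff _ List.mem_cons_self) 0
      exact mul_eq_right₀ (sub_ne_zero.2 hne) |>.1 (f.exp_sum_logVar_path_sub_mul _ hoff)
  obtain ⟨w, hw⟩ := Complex.exp_eq_one_iff.1 hexp
  refine ⟨w, ?_, hw⟩
  have him : (C.darts.map fun d => polygonalAngle (f.line d) (f.pos u)).sum = w * (2 * π) := by
    have hsum := congrArg Complex.imAddGroupHom hw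
    rw [map_list_sum, List.map_map] at hsum
    rw [List.map_congr_left fun d hd => (f.im_logVar_path_sub (hoff d hd)).symm]
    exact hsum.trans (by simp)
  rw [winding, polygonalWinding_closedLine, him, mul_div_cancel_right₀ _ Real.two_pi_pos.ne']

namespace IsAlmostEmbedding

variable {f : PLMap G}

theorem pos_notMem_edgeImage (hf : f.IsAlmostEmbedding) {v : V} {d : G.Dart} (hfst : v ≠ d.fst)
    (hsnd : v ≠ d.snd) : f.pos v ∉ f.edgeImage d :=
  hf.vertex_edge v d fun h => (Sym2.mem_iff.1 h).elim hfst hsnd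

theorem path_ne_path (hf : f.IsAlmostEmbedding) {d e : G.Dart} (h₁ : d.fst ≠ e.fst)
    (h₂ : d.fst ≠ e.snd) (h₃ : d.snd ≠ e.fst) (h₄ : d.snd ≠ e.snd) (s t : I) :
    f.path d s ≠ f.path e t := by
  refine (hf.edge_edge d e fun v hd he => ?_).ne_of_mem (f.path_mem_edgeImage d s)
    (f.path_mem_edgeImage e t)
  rcases Sym2.mem_iff.1 hd with rfl | rfl
  exacts [(Sym2.mem_iff.1 he).elim h₁ h₂, (Sym2.mem_iff.1 he).elim h₃ h₄]

end IsAlmostEmbedding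

end PLMap

/-! ### Triangles in almost embedded graphs -/

namespace PLMap.IsAlmostEmbedding

variable {V : Type*} {G : SimpleGraph V} {f : PLMap G} {a b i j k : V}

theorem pos_notMem_cycleImage (hf : f.IsAlmostEmbedding) {u v : V} {C : G.Walk v v}
    (h : u ∉ C.support) : f.pos u ∉ f.cycleImage C := by
  rintro ⟨d, hd, hmem⟩
  exact hf.pos_notMem_edgeImage
    (ne_of_mem_of_not_mem (C.dart_fst_mem_support_of_mem_darts hd) h).symm
    (ne_of_mem_of_not_mem (C.dart_snd_mem_support_of_mem_darts hd) h).symm hmem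

/-- The image of the path `aib` of the graph, marked at the image of `i`. -/
def markedPath (hf : f.IsAlmostEmbedding) (hab : a ≠ b) (hai : G.Adj a i) (hib : G.Adj i b) :
    MarkedPath (f.pos a) (f.pos b) where
  α := f.path ⟨(a, i), hai⟩
  β := f.path ⟨(i, b), hib⟩
  α_ne := path_ne (hf.pos_notMem_edgeImage hab.symm hib.ne')
  β_ne := path_ne (hf.pos_notMem_edgeImage hai.ne hab)

theorem markedPath_compat (hf : f.IsAlmostEmbedding) (hab : a ≠ b) (hai : G.Adj a i)
    (hib : G.Adj i b) (haj : G.Adj a j) (hjb : G.Adj j b) (hij : i ≠ j) :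
    (hf.markedPath hab hai hib).Compat (hf.markedPath hab haj hjb) :=
  ⟨hf.path_ne_path haj.ne hab hij hib.ne, hf.path_ne_path hai.ne hab hij.symm hjb.ne⟩

theorem isSide_path (hf : f.IsAlmostEmbedding) (hab : a ≠ b) (hai : G.Adj a i)
    (hib : G.Adj i b) (haj : G.Adj a j) (hjb : G.Adj j b) (hak : G.Adj a k) (hkb : G.Adj k b)
    (hij : G.Adj i j) (hki : k ≠ i) (hkj : k ≠ j) :
    MarkedPath.IsSide (hf.markedPath hab hai hib) (hf.markedPath hab haj hjb)
      (hf.markedPath hab hak hkb) (f.path ⟨(i, j), hij⟩) where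
  ne_left := path_ne (hf.pos_notMem_edgeImage hai.ne haj.ne)
  ne_right := path_ne (hf.pos_notMem_edgeImage hib.ne' hjb.ne')
  α_ne := hf.path_ne_path hai.ne haj.ne hki hkj
  β_ne := hf.path_ne_path hki hkj hib.ne' hjb.ne'

theorem exists_sum_logVar_triangle_sub_eq (hf : f.IsAlmostEmbedding) (hab : a ≠ b)
    (hij : G.Adj i j) (hjk : G.Adj j k) (hki : G.Adj k i) (hai : G.Adj a i) (haj : G.Adj a j)
    (hak : G.Adj a k) (hib : G.Adj i b) (hjb : G.Adj j b) (hkb : G.Adj k b) :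
    let D := (SimpleGraph.Walk.cons hij (.cons hjk (.cons hki .nil))).darts
    ∃ d : ℤ, (d = 1 ∨ d = -1) ∧ (D.map fun e => logVar fun t => f.path e t - f.pos a).sum -
      (D.map fun e => logVar fun t => f.path e t - f.pos b).sum = d * (2 * π * Complex.I) := by
  have side₁ := hf.isSide_path hab hai hib haj hjb hak hkb hij hki.ne hjk.ne'
  have side₂ := hf.isSide_path hab haj hjb hak hkb hai hib hjk hij.ne hki.ne'
  have side₃ := hf.isSide_path hab hak hkb hai hib haj hjb hki hjk.ne hij.ne'
  obtain ⟨d, hd, hsum⟩ := MarkedPath.exists_logVar_triangle_eq (hf.vertex_vertex a b hab)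
    (hf.markedPath_compat hab hai hib haj hjb hij.ne)
    (hf.markedPath_compat hab haj hjb hak hkb hjk.ne)
    (hf.markedPath_compat hab hak hkb hai hib hki.ne) side₁ side₂ side₃
  refine ⟨d, hd, ?_⟩
  simp only [SimpleGraph.Walk.darts_cons, SimpleGraph.Walk.darts_nil, List.map_cons,
    List.map_nil, List.sum_cons, List.sum_nil, add_zero]
  exact hsum

end PLMap.IsAlmostEmbedding

theorem theorem5p5_general {V : Type*} {G : SimpleGraph V} (f : PLMap G)
    (hf : f.IsAlmostEmbedding) {a b i j k : V} (hab : a ≠ b) (hij : G.Adj i j)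
    (hjk : G.Adj j k) (hki : G.Adj k i) (hai : G.Adj a i) (haj : G.Adj a j) (hak : G.Adj a k)
    (hib : G.Adj i b) (hjb : G.Adj j b) (hkb : G.Adj k b) :
    let C : G.Walk i i := .cons hij (.cons hjk (.cons hki .nil))
    f.pos a ∉ f.cycleImage C ∧ f.pos b ∉ f.cycleImage C ∧
    ∃ w w' : ℤ, f.winding C a = w ∧ f.winding C b = w' ∧ w - w' ≡ 1 [ZMOD 2] ∧
      (w - w' = 1 ∨ w - w' = -1) := by
  intro C
  have off_a : f.pos a ∉ f.cycleImage C :=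
    hf.pos_notMem_cycleImage (by simp [C, hai.ne, haj.ne, hak.ne])
  have off_b : f.pos b ∉ f.cycleImage C :=
    hf.pos_notMem_cycleImage (by simp [C, hib.ne', hjb.ne', hkb.ne'])
  obtain ⟨w, hw, hsum⟩ := f.exists_int_winding_eq off_a
  obtain ⟨w', hw', hsum'⟩ := f.exists_int_winding_eq off_b
  obtain ⟨d, hd, hdiff⟩ :=
    hf.exists_sum_logVar_triangle_sub_eq hab hij hjk hki hai haj hak hib hjb hkb
  have hwd : w - w' = d := by
    rw [hsum, hsum', ← sub_mul, mul_left_inj' Complex.two_pi_I_ne_zero] at hdiff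
    exact_mod_cast hdiff
  refine ⟨off_a, off_b, w, w', hw, hw', ?_, hwd ▸ hd⟩
  rw [hwd]
  rcases hd with rfl | rfl <;> rfl

end

theorem theorem5p5 (f : PLMap K5minus45) (hf : f.IsAlmostEmbedding) :
    f.pos 3 ∉ f.cycleImage cycle123 ∧ f.pos 4 ∉ f.cycleImage cycle123 ∧
    ∃ w₄ w₅ : ℤ, f.winding cycle123 3 = w₄ ∧ f.winding cycle123 4 = w₅ ∧
      w₄ - w₅ ≡ 1 [ZMOD 2] ∧
      (w₄ - w₅ = 1 ∨ w₄ - w₅ = -1) := by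
  apply theorem5p5_general f hf <;> simp [K5minus45]
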